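/- Let $H$ be a complex Hilbert space, let $X\subset\mathcal B(H)$ be a subset with a distinguished point $x_0\in X$ (a pointed operator metric space), and let $n\ge 1$ be an integer. For $[x_{ij}],[y_{ij}]\in \mathrm M_n(X)$ let $\|[x_{ij}-y_{ij}]\|$ be the norm of $[x_{ij}-y_{ij}]$ as an operator on $H^{\oplus n}$ (the Hilbert direct sum); scalar matrices carry the operator norm between Euclidean spaces. Let $\mathrm{Lip}_0^n(X,\mathbb C)$ be the space of Lipschitz functions $f:X\to\mathbb C$ with $f(x_0)=0$, with the matrix norms, for $k\ge 1$ and $[f_{rs}]\in \mathrm M_k(\mathrm{Lip}_0^n(X,\mathbb C))$, $$\|[f_{rs}]\|_{\mathrm{Lip},n,k}=\sup\left\{\frac{\|[f_{rs}(x_{ij})-f_{rs}(y_{ij})]\|_{\mathrm M_{nk}}}{\|[x_{ij}-y_{ij}]\|} \;:\; [x_{ij}]\ne[y_{ij}]\in \mathrm M_n(X)\right\}$$ (the supremum being $0$ if $X$ is a single point). Let its dual $\mathrm{Lip}_0^n(X,\mathbb C)^*$ carry the standard matrix norms $\mathrm M_m(E^*)=\mathrm{CB}(E,\mathrm M_m)$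 (completely bounded norm), let $\delta_x$ denote evaluation at $x$, and let the $n$-Lipschitz-free operator space $\mathcal F^n(X)$ be the closed linear span of $\{\delta_x\}_{x\in X}$ in $\mathrm{Lip}_0^n(X,\mathbb C)^*$, with the inherited matrix norms. Put $F=\mathrm{span}\{\delta_x\}_{x\in X}\subset\mathcal F^n(X)$. **Theorem.** For every integer $m\ge 1$ and every $\mu\in \mathrm M_m(F)$, $$\|\mu\|_{\mathrm M_m(\mathcal F^n(X))}=\inf\Big\{\|\alpha\|\,\|\beta\|\max_{1\le \ell\le N}|c_\ell|\,\big\|[x^\ell_{ij}-y^\ell_{ij}]\big\|\Big\},$$ where the infimum is taken over all integers $N\ge 1$ and all representations $\mu=\alpha\cdot D\cdot\beta$ in which $\alpha\in \mathrm M_{m,Nn}(\mathbb C)$ and $\beta\in \mathrm M_{Nn,m}(\mathbb C)$ are scalar matrices and $D\in \mathrm M_N(\mathrm M_n(F))$ is a block-diagonal matrix whose $\ell$-th diagonal block is $c_\ell[\delta_{x^\ell_{ij}}-\delta_{y^\ell_{ij}}]_{ij}$, with $c_\ell\in\mathbb C$ and $[x^\ell_{ij}],[y^\ell_{ij}]\in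 \mathrm M_n(X)$ for $1\le\ell\le N$. (In particular, such representations of $\mu$ exist.) -/

import Mathlib

open scoped Matrix.Norms.L2Operator NNReal

noncomputable section

namespace OpLip

/-! ### Euclidean operator norms of scalar matrices

Scalar matrices carry the operator norm between Euclidean spaces throughout; the scalar matrix
space `M_n(M_k)` is identified with the matrices indexed by `Fin n × Fin k`. -/

section Scalar

set_option linter.unusedSectionVars false

variable {ι κ : Type*} [Fintype ι] [Fintype κ] [DecidableEq ι] [DecidableEq κ]

theorem norm_pairing_le (A : Matrix ι κ ℂ) (ξ : ι → ℂ) (η : κ → ℂ) :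
    ‖∑ p, ∑ q, star (ξ p) * A p q * η q‖ ≤ ‖A‖ * (‖WithLp.toLp 2 ξ‖ * ‖WithLp.toLp 2 η‖) := by
  have h1 : ∑ p, ∑ q, star (ξ p) * A p q * η q
      = inner ℂ (WithLp.toLp 2 ξ) (WithLp.toLp 2 (A.mulVec η)) := by
    simp only [PiLp.inner_apply, RCLike.inner_apply, Matrix.mulVec, dotProduct, Finset.sum_mul]
    refine Finset.sum_congr rfl fun p _ => Finset.sum_congr rfl fun q _ => ?_
    simp only [RCLike.star_def]
    ring
  rw [h1]
  refine (norm_inner_le_norm _ _).trans ?_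
  have h2 := A.l2_opNorm_mulVec (WithLp.toLp 2 η)
  have h3 : ‖WithLp.toLp 2 (A.mulVec η)‖ ≤ ‖A‖ * ‖WithLp.toLp 2 η‖ := h2
  calc _ ≤ ‖WithLp.toLp 2 ξ‖ * (‖A‖ * ‖WithLp.toLp 2 η‖) := by gcongr
    _ = _ := by ring

theorem norm_le_of_pairing (A : Matrix ι κ ℂ) {C : ℝ} (hC : 0 ≤ C)
    (h : ∀ (ξ : ι → ℂ) (η : κ → ℂ), ‖∑ p, ∑ q, star (ξ p) * A p q * η q‖
      ≤ C * (‖WithLp.toLp 2 ξ‖ * ‖WithLp.toLp 2 η‖)) : ‖A‖ ≤ C := by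
  rw [Matrix.l2_opNorm_def]
  refine ContinuousLinearMap.opNorm_le_bound _ hC fun v => ?_
  set w : EuclideanSpace ℂ ι := WithLp.toLp 2 (A.mulVec v.ofLp) with hw
  change ‖w‖ ≤ C * ‖v‖
  have h1 : ∑ p, ∑ q, star (w.ofLp p) * A p q * v.ofLp q = inner ℂ w w := by
    simp only [PiLp.inner_apply, RCLike.inner_apply, RCLike.star_def]
    refine Finset.sum_congr rfl fun p _ => ?_
    have : w.ofLp p = ∑ q, A p q * v.ofLp q := rfl
    rw [this, Finset.sum_mul]
    refine Finset.sum_congr rfl fun q _ => ?_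
    ring
  have h2 := h w.ofLp v.ofLp
  rw [h1, inner_self_eq_norm_sq_to_K] at h2
  have h3 : ‖w‖ ^ 2 ≤ C * (‖w‖ * ‖v‖) := by simpa using h2
  rcases (norm_nonneg w).eq_or_lt with h0 | h0
  · rw [← h0]; positivity
  · nlinarith

theorem norm_coord_le (ξ : ι → ℂ) (p : ι) : ‖ξ p‖ ≤ ‖WithLp.toLp 2 ξ‖ :=
  PiLp.norm_apply_le (WithLp.toLp 2 ξ) p

theorem norm_le_sum_entries (A : Matrix ι κ ℂ) : ‖A‖ ≤ ∑ p, ∑ q, ‖A p q‖ := by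
  refine norm_le_of_pairing A (by positivity) fun ξ η => ?_
  refine (norm_sum_le _ _).trans ?_
  rw [Finset.sum_mul]
  refine Finset.sum_le_sum fun p _ => ?_
  refine (norm_sum_le _ _).trans ?_
  rw [Finset.sum_mul]
  refine Finset.sum_le_sum fun q _ => ?_
  rw [norm_mul, norm_mul, norm_star]
  have := mul_le_mul (norm_coord_le ξ p) (norm_coord_le η q) (norm_nonneg _) (norm_nonneg _)
  nlinarith [norm_nonneg (A p q)]

theorem norm_entry_le (A : Matrix ι κ ℂ) (p : ι) (q : κ) : ‖A p q‖ ≤ ‖A‖ := by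
  have h := norm_pairing_le A (Pi.single p 1) (Pi.single q 1)
  simpa [Pi.single_apply, Finset.sum_ite_eq, apply_ite, ite_mul, mul_ite] using h

end Scalar

variable {H : Type*} [NormedAddCommGroup H] [InnerProductSpace ℂ H]

/-! ### Operator metric spaces

An operator metric space is a subset `X` of `B(H)`; its elements are bounded operators, and
`M_n(X)` is `Matrix (Fin n) (Fin n) X`. -/

/-- The operator on the Hilbert sum `H ⊕ ⋯ ⊕ H` of `n` copies of `H` given by an `n × n` matrix
of bounded operators on `H`. -/
def blockOp {n : ℕ} (A : Matrix (Fin n) (Fin n) (H →L[ℂ] H)) :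
    PiLp 2 (fun _ : Fin n => H) →L[ℂ] PiLp 2 (fun _ : Fin n => H) :=
  ((PiLp.continuousLinearEquiv 2 ℂ (fun _ : Fin n => H)).symm :
      (Fin n → H) →L[ℂ] PiLp 2 (fun _ : Fin n => H)) ∘L
    ContinuousLinearMap.pi fun i => ∑ j, (A i j) ∘L (PiLp.proj 2 (fun _ : Fin n => H) j)

variable {X : Set (H →L[ℂ] H)}

/-- The distance `‖[x_ij - y_ij]‖` in `M_n(X)`. -/
def matDist {n : ℕ} (x y : Matrix (Fin n) (Fin n) X) : ℝ :=
  ‖blockOp (Matrix.of fun i j => (x i j : H →L[ℂ] H) - (y i j : H →L[ℂ] H))‖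

theorem matDist_nonneg {n : ℕ} (x y : Matrix (Fin n) (Fin n) X) : 0 ≤ matDist x y := by
  unfold matDist
  exact ContinuousLinearMap.opNorm_nonneg _

theorem dist_entry_le {n : ℕ} (x y : Matrix (Fin n) (Fin n) X) (i j : Fin n) :
    dist (x i j) (y i j) ≤ matDist x y := by
  rw [Subtype.dist_eq, dist_eq_norm]
  refine ContinuousLinearMap.opNorm_le_bound _ (matDist_nonneg _ _) fun h => ?_
  set B := blockOp (Matrix.of fun i j => (x i j : H →L[ℂ] H) - (y i j : H →L[ℂ] H)) with hB
  set v : PiLp 2 (fun _ : Fin n => H) := WithLp.toLp 2 (Pi.single j h) with hv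
  have h1 : ((x i j : H →L[ℂ] H) - (y i j : H →L[ℂ] H)) h = (B v) i := by
    have h2 : (B v) i
        = ∑ l, ((x i l : H →L[ℂ] H) - (y i l : H →L[ℂ] H)) ((Pi.single j h : Fin n → H) l) := by
      simp [hB, hv, blockOp, Pi.single_apply]
    rw [h2, Finset.sum_eq_single j]
    · simp
    · intro l _ hl
      simp [Pi.single_eq_of_ne hl]
    · simp
  rw [h1]
  have hvn : ‖v‖ = ‖h‖ := by
    rw [hv]; exact PiLp.norm_single 2 (fun _ : Fin n => H) j h
  calc ‖(B v) i‖ ≤ ‖B v‖ := PiLp.norm_apply_le _ _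
    _ ≤ ‖B‖ * ‖v‖ := B.le_opNorm v
    _ = matDist x y * ‖h‖ := by rw [hvn]; rfl

/-! ### The `n`-th Lipschitz constant of a map into a space of scalar matrices -/

/-- The matrix `F_n(x) - F_n(y)` in `M_n(M_k)`, for `F : X → M_k` and `x, y ∈ M_n(X)`. -/
def ampDiff {n k : ℕ} (F : X → Matrix (Fin k) (Fin k) ℂ) (x y : Matrix (Fin n) (Fin n) X) :
    Matrix (Fin n × Fin k) (Fin n × Fin k) ℂ :=
  Matrix.of fun p q => F (x p.1 q.1) p.2 q.2 - F (y p.1 q.1) p.2 q.2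

/-- `Lip_n(F)`: the Lipschitz constant of the `n`-th amplification `M_n(X) → M_n(M_k)`.
(The pairs with `x = y` contribute the value `0`.) -/
def lipConst (n : ℕ) {k : ℕ} (F : X → Matrix (Fin k) (Fin k) ℂ) : ℝ :=
  ⨆ p : Matrix (Fin n) (Fin n) X × Matrix (Fin n) (Fin n) X,
    ‖ampDiff F p.1 p.2‖ / matDist p.1 p.2

variable (X) in
/-- The complex Lipschitz functions on `X` that vanish at the base point. -/
def lipZero (x₀ : X) : Submodule ℂ (X → ℂ) where
  carrier := {f | (∃ K : ℝ≥0, LipschitzWith K f) ∧ f x₀ = 0}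
  add_mem' := by
    rintro f g ⟨⟨K, hK⟩, hf⟩ ⟨⟨L, hL⟩, hg⟩
    exact ⟨⟨K + L, hK.add hL⟩, by simp [hf, hg]⟩
  zero_mem' := ⟨⟨0, LipschitzWith.const 0⟩, rfl⟩
  smul_mem' := by
    rintro c f ⟨⟨K, hK⟩, hf⟩
    exact ⟨⟨‖c‖₊ * K, (lipschitzWith_smul c).comp hK⟩, by simp [hf]⟩

variable (X) in
/-- The space `Lip_0^n(X, ℂ)`: Lipschitz functions vanishing at the base point, to be normed by
`Lip_n`. -/
def LipZero (n : ℕ) (x₀ : X) : Type _ :=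
  let _ := n
  lipZero X x₀

variable {n k m : ℕ} {x₀ : X}

instance : AddCommGroup (LipZero X n x₀) := inferInstanceAs (AddCommGroup (lipZero X x₀))

instance : Module ℂ (LipZero X n x₀) := inferInstanceAs (Module ℂ (lipZero X x₀))

instance : CoeFun (LipZero X n x₀) fun _ => X → ℂ := ⟨fun f => f.1⟩

@[simp] theorem LipZero.add_apply (f g : LipZero X n x₀) (x : X) : (f + g) x = f x + g x := rfl

@[simp] theorem LipZero.smul_apply (c : ℂ) (f : LipZero X n x₀) (x : X) : (c • f) x = c * f x := rfl

theorem LipZero.ext {f g : LipZero X n x₀} (h : ∀ x, f x = g x) : f = g :=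
  Subtype.ext (funext h)

/-- The functional "evaluation at `x`" as a linear map. -/
def evalₗ (n : ℕ) (x : X) : LipZero X n x₀ →ₗ[ℂ] ℂ where
  toFun f := f x
  map_add' _ _ := rfl
  map_smul' _ _ := rfl

/-- The norm `‖[f_rs]‖_{Lip,n,k} = Lip_n([f_rs] : X → M_k)` on `M_k(Lip_0^n(X, ℂ))`. -/
def lipMatNorm (f : Matrix (Fin k) (Fin k) (LipZero X n x₀)) : ℝ :=
  lipConst n fun x => Matrix.of fun r s => f r s x

/-- The norm of `Lip_0^n(X, ℂ)` is its first matrix norm. -/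
instance : Norm (LipZero X n x₀) := ⟨fun f => lipMatNorm (Matrix.of fun _ _ : Fin 1 => f)⟩

theorem norm_def (f : LipZero X n x₀) :
    ‖f‖ = lipMatNorm (Matrix.of fun _ _ : Fin 1 => f) := rfl

theorem lip_bddAbove (f : Matrix (Fin k) (Fin k) (LipZero X n x₀)) :
    BddAbove (Set.range fun p : Matrix (Fin n) (Fin n) X × Matrix (Fin n) (Fin n) X =>
      ‖ampDiff (fun x => Matrix.of fun r s => f r s x) p.1 p.2‖ / matDist p.1 p.2) := by
  choose K hK using fun r s => (f r s).2.1
  refine ⟨∑ p : Fin n × Fin k, ∑ q : Fin n × Fin k, (K p.2 q.2 : ℝ), ?_⟩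
  rintro _ ⟨⟨x, y⟩, rfl⟩
  refine div_le_of_le_mul₀ (matDist_nonneg _ _) (by positivity) ?_
  refine (norm_le_sum_entries _).trans ?_
  rw [Finset.sum_mul]
  refine Finset.sum_le_sum fun p _ => ?_
  rw [Finset.sum_mul]
  refine Finset.sum_le_sum fun q _ => ?_
  have h1 := (hK p.2 q.2).dist_le_mul (x p.1 q.1) (y p.1 q.1)
  rw [dist_eq_norm] at h1
  refine le_trans (le_of_eq rfl) (h1.trans ?_)
  exact mul_le_mul_of_nonneg_left (dist_entry_le x y p.1 q.1) (K p.2 q.2).2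

theorem lipMatNorm_nonneg (f : Matrix (Fin k) (Fin k) (LipZero X n x₀)) : 0 ≤ lipMatNorm f :=
  Real.iSup_nonneg fun _ => div_nonneg (norm_nonneg _) (matDist_nonneg _ _)

theorem ampDiff_le (f : Matrix (Fin k) (Fin k) (LipZero X n x₀)) (x y : Matrix (Fin n) (Fin n) X) :
    ‖ampDiff (fun x => Matrix.of fun r s => f r s x) x y‖ ≤ lipMatNorm f * matDist x y := by
  rcases (matDist_nonneg x y).eq_or_lt with h0 | h0
  · have hxy : x = y := by
      ext1 i j
      have := dist_entry_le x y i j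
      rw [← h0] at this
      exact dist_le_zero.1 this
    subst hxy
    have : ampDiff (fun x => Matrix.of fun r s => f r s x) x x = 0 := by
      ext p q; simp [ampDiff]
    rw [this, norm_zero, ← h0, mul_zero]
  · rw [← div_le_iff₀ h0]
    exact le_ciSup (lip_bddAbove f) (x, y)

theorem lipMatNorm_le (f : Matrix (Fin k) (Fin k) (LipZero X n x₀)) {C : ℝ} (hC : 0 ≤ C)
    (h : ∀ x y : Matrix (Fin n) (Fin n) X,
      ‖ampDiff (fun x => Matrix.of fun r s => f r s x) x y‖ ≤ C * matDist x y) :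
    lipMatNorm f ≤ C :=
  Real.iSup_le (fun p => div_le_of_le_mul₀ (matDist_nonneg _ _) hC (h p.1 p.2)) hC

theorem norm_eval_le [NeZero n] (f : LipZero X n x₀) (x : X) :
    ‖f x‖ ≤ matDist (n := n) (Matrix.of fun _ _ => x) (Matrix.of fun _ _ => x₀) * ‖f‖ := by
  have h1 := ampDiff_le (Matrix.of fun _ _ : Fin 1 => f)
    (Matrix.of fun _ _ : Fin n => x) (Matrix.of fun _ _ => x₀)
  have h2 := norm_entry_le (ampDiff (fun x => Matrix.of fun r s : Fin 1 =>
    (Matrix.of fun _ _ : Fin 1 => f) r s x)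
    (Matrix.of fun _ _ : Fin n => x) (Matrix.of fun _ _ => x₀)) (0, 0) (0, 0)
  have h3 : f x₀ = 0 := f.2.2
  simp only [ampDiff, Matrix.of_apply, h3, sub_zero] at h1 h2
  rw [mul_comm]
  exact h2.trans h1

theorem lipZero_core [NeZero n] : NormedSpace.Core ℂ (LipZero X n x₀) where
  norm_nonneg f := lipMatNorm_nonneg _
  norm_smul c f := by
    have : ∀ p : Matrix (Fin n) (Fin n) X × Matrix (Fin n) (Fin n) X,
        ‖ampDiff (fun x => Matrix.of fun r s : Fin 1 =>
          (Matrix.of fun _ _ : Fin 1 => c • f) r s x) p.1 p.2‖ / matDist p.1 p.2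
        = ‖c‖ * (‖ampDiff (fun x => Matrix.of fun r s : Fin 1 =>
          (Matrix.of fun _ _ : Fin 1 => f) r s x) p.1 p.2‖ / matDist p.1 p.2) := by
      intro p
      rw [← mul_div_assoc, ← norm_smul]
      congr 2
      ext a b
      simp [ampDiff, mul_sub]
    rw [norm_def, norm_def, lipMatNorm, lipConst, lipMatNorm, lipConst,
      Real.mul_iSup_of_nonneg (norm_nonneg c)]
    exact iSup_congr this
  norm_triangle f g := by
    refine lipMatNorm_le _ (add_nonneg (lipMatNorm_nonneg _) (lipMatNorm_nonneg _)) fun x y => ?_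
    have h1 := ampDiff_le (Matrix.of fun _ _ : Fin 1 => f) x y
    have h2 := ampDiff_le (Matrix.of fun _ _ : Fin 1 => g) x y
    rw [add_mul]
    refine le_trans (le_trans (le_of_eq ?_) (norm_add_le _ _)) (add_le_add h1 h2)
    congr 1
    ext a b
    simp [ampDiff]
    ring
  norm_eq_zero_iff f := by
    constructor
    · intro h
      refine LipZero.ext fun x => ?_
      have := norm_eval_le f x
      rw [h, mul_zero] at this
      exact norm_le_zero_iff.1 this
    · rintro rfl
      refine le_antisymm (lipMatNorm_le _ le_rfl fun x y => ?_) (lipMatNorm_nonneg _)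
      rw [zero_mul]
      refine le_of_eq (norm_eq_zero.2 ?_)
      ext a b
      simp only [ampDiff, Matrix.of_apply, Matrix.zero_apply]
      exact sub_self (0 : ℂ)

instance [NeZero n] : NormedAddCommGroup (LipZero X n x₀) := NormedAddCommGroup.ofCore lipZero_core

instance [NeZero n] : NormedSpace ℂ (LipZero X n x₀) := NormedSpace.ofCore lipZero_core

/-! ### The dual operator space and the `n`-Lipschitz-free operator space -/

variable [NeZero n]

/-- The `k`-th amplification `M_k(Lip_0^n(X, ℂ)) → M_k(M_m)` of a linear map
`T : Lip_0^n(X, ℂ) → M_m`. -/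
def amplify (T : LipZero X n x₀ →ₗ[ℂ] Matrix (Fin m) (Fin m) ℂ)
    (f : Matrix (Fin k) (Fin k) (LipZero X n x₀)) :
    Matrix (Fin k × Fin m) (Fin k × Fin m) ℂ :=
  Matrix.of fun p q => T (f p.1 q.1) p.2 q.2

/-- The values of all amplifications of `T` on the unit balls of `M_k(Lip_0^n(X, ℂ))`. -/
def cbSet (T : LipZero X n x₀ →ₗ[ℂ] Matrix (Fin m) (Fin m) ℂ) : Set ℝ :=
  {t | ∃ (k : ℕ) (f : Matrix (Fin k) (Fin k) (LipZero X n x₀)),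
    lipMatNorm f ≤ 1 ∧ t = ‖amplify T f‖}

/-- The completely bounded norm of a linear map `T : Lip_0^n(X, ℂ) → M_m`. -/
def cbNorm (T : LipZero X n x₀ →ₗ[ℂ] Matrix (Fin m) (Fin m) ℂ) : ℝ := sSup (cbSet T)

/-- The map `Lip_0^n(X, ℂ) → M_m`, `f ↦ [μ_ab(f)]`, given by a matrix of functionals. -/
def toMatrixMap (μ : Matrix (Fin m) (Fin m) (StrongDual ℂ (LipZero X n x₀))) :
    LipZero X n x₀ →ₗ[ℂ] Matrix (Fin m) (Fin m) ℂ where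
  toFun f := Matrix.of fun a b => μ a b f
  map_add' f g := by ext a b; simp
  map_smul' c f := by ext a b; simp

/-- The norm of `M_m(Lip_0^n(X, ℂ)^*)`, through `M_m(E^*) ≅ CB(E, M_m)`. -/
def dualMatNorm (μ : Matrix (Fin m) (Fin m) (StrongDual ℂ (LipZero X n x₀))) : ℝ :=
  cbNorm (toMatrixMap μ)

set_option linter.unusedSectionVars false in
/-- Compressing a matrix of functions by two vectors does not increase the norm. -/
theorem norm_compress_le (f : Matrix (Fin k) (Fin k) (LipZero X n x₀)) (ξ η : Fin k → ℂ) :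
    ‖(∑ r, ∑ s, (star (ξ r) * η s) • f r s : LipZero X n x₀)‖
      ≤ lipMatNorm f * (‖WithLp.toLp 2 ξ‖ * ‖WithLp.toLp 2 η‖) := by
  have hn := lipMatNorm_nonneg f
  have happ : ∀ x : X, (∑ r, ∑ s, (star (ξ r) * η s) • f r s : LipZero X n x₀) x
      = ∑ r, ∑ s, (star (ξ r) * η s) * f r s x := by
    intro x
    change evalₗ n x _ = _
    simp only [map_sum, map_smul]
    rfl
  have htensor : ∀ (u : Fin n × Fin 1 → ℂ) (ζ : Fin k → ℂ),
      ‖WithLp.toLp 2 (fun p : Fin n × Fin k => u (p.1, 0) * ζ p.2)‖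
        = ‖WithLp.toLp 2 u‖ * ‖WithLp.toLp 2 ζ‖ := by
    intro u ζ
    refine (sq_eq_sq₀ (norm_nonneg _) (by positivity)).1 ?_
    rw [mul_pow, EuclideanSpace.norm_sq_eq, EuclideanSpace.norm_sq_eq, EuclideanSpace.norm_sq_eq]
    simp only [Fintype.sum_prod_type, norm_mul, mul_pow, Finset.sum_mul_sum]
    simp
  refine lipMatNorm_le _ (by positivity) fun x y => ?_
  have hd := matDist_nonneg x y
  refine norm_le_of_pairing _ (by positivity) fun u v => ?_
  have key := norm_pairing_le (ampDiff (fun x => Matrix.of fun r s => f r s x) x y)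
    (fun p : Fin n × Fin k => u (p.1, 0) * ξ p.2) (fun p : Fin n × Fin k => v (p.1, 0) * η p.2)
  rw [htensor, htensor] at key
  have hle := ampDiff_le f x y
  refine le_trans (le_trans (le_of_eq ?_) key) ?_
  · congr 1
    simp only [ampDiff, Matrix.of_apply, Fintype.sum_prod_type, happ, Finset.univ_unique,
      Finset.sum_singleton, Fin.default_eq_zero, Finset.mul_sum, Finset.sum_mul,
      ← Finset.sum_sub_distrib, Fin.isValue, star_mul']
    refine Finset.sum_congr rfl fun i _ => ?_
    rw [Finset.sum_comm]
    refine Finset.sum_congr rfl fun r _ => Finset.sum_congr rfl fun j _ =>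
      Finset.sum_congr rfl fun s _ => ?_
    ring
  · calc _ ≤ (lipMatNorm f * matDist x y) * (‖WithLp.toLp 2 u‖ * ‖WithLp.toLp 2 ξ‖
          * (‖WithLp.toLp 2 v‖ * ‖WithLp.toLp 2 η‖)) := by gcongr
      _ = _ := by ring

/-- Every matrix of bounded functionals is completely bounded, so `dualMatNorm` is a genuine
supremum. -/
theorem cbSet_bddAbove (μ : Matrix (Fin m) (Fin m) (StrongDual ℂ (LipZero X n x₀))) :
    BddAbove (cbSet (toMatrixMap μ)) := by
  refine ⟨∑ a, ∑ b, ‖μ a b‖, ?_⟩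
  rintro _ ⟨k, f, hf, rfl⟩
  refine norm_le_of_pairing _ (by positivity) fun ξ η => ?_
  have hsl : ∀ (ζ : Fin k × Fin m → ℂ) (a : Fin m),
      ‖WithLp.toLp 2 (fun r => ζ (r, a))‖ ≤ ‖WithLp.toLp 2 ζ‖ := by
    intro ζ a
    refine (sq_le_sq₀ (norm_nonneg _) (norm_nonneg _)).1 ?_
    rw [EuclideanSpace.norm_sq_eq, EuclideanSpace.norm_sq_eq, Fintype.sum_prod_type]
    exact Finset.sum_le_sum fun r _ =>
      Finset.single_le_sum (f := fun a => ‖ζ (r, a)‖ ^ 2) (fun _ _ => sq_nonneg _)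
        (Finset.mem_univ a)
  have hrw : ∑ p, ∑ q, star (ξ p) * amplify (toMatrixMap μ) f p q * η q
      = ∑ a, ∑ b, μ a b (∑ r, ∑ s, (star (ξ (r, a)) * η (s, b)) • f r s) := by
    simp only [map_sum, map_smul, smul_eq_mul, Fintype.sum_prod_type]
    rw [Finset.sum_comm]
    refine Finset.sum_congr rfl fun a _ => ?_
    rw [Finset.sum_comm' (s := Finset.univ) (t := fun _ => Finset.univ)
      (t' := Finset.univ) (s' := fun _ => Finset.univ) (by simp)]
    rw [Finset.sum_comm]
    rw [Finset.sum_comm (s := (Finset.univ : Finset (Fin m)))]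
    refine Finset.sum_congr rfl fun r _ => ?_
    rw [Finset.sum_comm]
    refine Finset.sum_congr rfl fun b _ => Finset.sum_congr rfl fun s _ => ?_
    simp only [amplify, toMatrixMap, Matrix.of_apply, LinearMap.coe_mk, AddHom.coe_mk]
    ring
  rw [hrw, Finset.sum_mul]
  refine (norm_sum_le _ _).trans (Finset.sum_le_sum fun a _ => ?_)
  rw [Finset.sum_mul]
  refine (norm_sum_le _ _).trans (Finset.sum_le_sum fun b _ => ?_)
  refine ((μ a b).le_opNorm _).trans ?_
  refine mul_le_mul_of_nonneg_left ?_ (norm_nonneg _)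
  refine (norm_compress_le f (fun r => ξ (r, a)) (fun s => η (s, b))).trans ?_
  calc _ ≤ 1 * (‖WithLp.toLp 2 ξ‖ * ‖WithLp.toLp 2 η‖) := by
        gcongr
        · exact hsl ξ a
        · exact hsl η b
    _ = _ := one_mul _

variable (n x₀) in
/-- The evaluation functional `δ_x`, as an element of `Lip_0^n(X, ℂ)^*`. -/
def delta (x : X) : StrongDual ℂ (LipZero X n x₀) :=
  (evalₗ n x).mkContinuous _ fun f => norm_eval_le f x

variable (X n x₀) in
/-- The `n`-Lipschitz-free operator space `F^n(X)`: the closed linear span of the functionals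
`δ_x` in `Lip_0^n(X, ℂ)^*`. -/
def FreeSpace : Submodule ℂ (StrongDual ℂ (LipZero X n x₀)) :=
  (Submodule.span ℂ (Set.range (delta n x₀))).topologicalClosure

variable (n x₀) in
/-- `δ_x` as an element of `F^n(X)`. -/
def freeDelta (x : X) : FreeSpace X n x₀ :=
  ⟨delta n x₀ x,
    Submodule.le_topologicalClosure _ (Submodule.subset_span (Set.mem_range_self x))⟩

variable (X n x₀) in
/-- The (non-closed) linear span of the elements `δ_x` in `F^n(X)`. -/
def freeSpan : Submodule ℂ (FreeSpace X n x₀) :=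
  Submodule.span ℂ (Set.range (freeDelta n x₀))

/-- The norm of `M_m(F^n(X))`, inherited from `M_m(Lip_0^n(X, ℂ)^*)`. -/
def freeMatNorm (μ : Matrix (Fin m) (Fin m) (FreeSpace X n x₀)) : ℝ :=
  dualMatNorm (μ.map fun φ => (φ : StrongDual ℂ (LipZero X n x₀)))

/-- The product `α · D · β` of a matrix over a vector space with scalar matrices on both sides. -/
def sandwich {ι E : Type*} [Fintype ι] [AddCommGroup E] [Module ℂ E]
    (α : Matrix (Fin m) ι ℂ) (D : Matrix ι ι E) (β : Matrix ι (Fin m) ℂ) :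
    Matrix (Fin m) (Fin m) E :=
  Matrix.of fun a b => ∑ p, ∑ q, (α a p * β q b) • D p q

/-- The `n × n` matrix `[δ_{x_ij} - δ_{y_ij}]` over `F^n(X)`. -/
def elemMatrix (x y : Matrix (Fin n) (Fin n) X) : Matrix (Fin n) (Fin n) (FreeSpace X n x₀) :=
  Matrix.of fun i j => freeDelta n x₀ (x i j) - freeDelta n x₀ (y i j)

end OpLip

end

/-! The norm is at most the cost of any representation by a direct estimate: evaluation at a matrix
of functions in the unit ball sends each block to a matrix of norm at most `|c| ‖[x_ij - y_ij]‖`,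
block-diagonal sums take the maximum, and the scalar factors contribute their norms
(`norm_ampMatrix_sandwich_blockDiagonal_le`).

The converse is a Hahn-Banach argument for matrix norms. Let `V` be the space of formal combinations
of points, `e_g` the matrices of differences of symbols and `d_g` the corresponding distances. To a
finite sum `∑ α e_g β` attach the Gram matrices `∑ d_g αα*` and `∑ d_g β*β`; the resulting triples
form a convex cone. If both Gram matrices are at most `t • 1`, stacking the factors gives a
block-diagonal representation of cost at most `t` (`exists_blockDiagonal_representation`).

If no such sum represents `μ`, the Riesz extension theorem gives positive functionals `p`, `q` and a
real functional `F` with `p 1 + q 1 = 1`, `F μ = t` and `F (α e_g β) ≤ d_g (p (αα*) + q (β*β))`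
(`exists_separating_functionals`). After an `ε`-perturbation, `p` and `q` are bounded by squared
Hilbert-Schmidt norms with invertible weights `S` and `T`. Dividing the complexified `F` by these
weights leaves a map `φ : V → M_m` with `‖φ(e_g)‖ ≤ 2 d_g`, and `F μ` is the real part of a pairing
of `φ(μ)` with the entries of `S` and `T*`.

Since `V` is free, `φ / 2` is a matrix of functions in the unit ball of `M_m(Lip_0^n)`, so `‖φ(μ)‖ ≤
2 ‖μ‖`. The weights satisfy `‖S‖ ‖T‖ ≤ (1 + 2εm) / 2` in Hilbert-Schmidt norm, hence `t ≤ ‖μ‖ (1 +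
2εm)`, which fails for `t > ‖μ‖` and small `ε`. -/

namespace OpLip

/-! ### Positive functionals on complex matrices and their density matrices -/

section Accretive

open scoped ComplexOrder

variable {ι κ : Type*} [Fintype ι] [Fintype κ]

/-- The cone of square complex matrices whose numerical range lies in the right half plane. -/
def accretiveCone (κ : Type*) [Fintype κ] : PointedCone ℝ (Matrix κ κ ℂ) where
  -- Hermitian symmetry is not required, so that the identity is an order unit for the real space of
  -- all complex matrices.
  carrier := {A | ∀ ξ : κ → ℂ, 0 ≤ (star ξ ⬝ᵥ A.mulVec ξ).re}
  add_mem' hA hB ξ := by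
    rw [Matrix.add_mulVec, dotProduct_add, Complex.add_re]
    exact add_nonneg (hA ξ) (hB ξ)
  zero_mem' ξ := by simp
  smul_mem' c A hA ξ := by
    have h : (c • A).mulVec ξ = (c : ℝ) • A.mulVec ξ := Matrix.smul_mulVec (c : ℝ) A ξ
    rw [h, dotProduct_smul, Complex.smul_re]
    exact mul_nonneg c.2 (hA ξ)

theorem star_dotProduct_self (ξ : κ → ℂ) : star ξ ⬝ᵥ ξ = ((∑ i, ‖ξ i‖ ^ 2 : ℝ) : ℂ) := by
  simp only [dotProduct, Pi.star_apply, RCLike.star_def, Complex.ofReal_sum, Complex.ofReal_pow]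
  exact Finset.sum_congr rfl fun i _ => Complex.conj_mul' (ξ i)

theorem conjTranspose_mul_self_mem_accretiveCone (B : Matrix ι κ ℂ) :
    B.conjTranspose * B ∈ accretiveCone κ := by
  intro ξ
  rw [← Matrix.mulVec_mulVec, Matrix.dotProduct_mulVec, ← Matrix.star_mulVec,
    star_dotProduct_self, Complex.ofReal_re]
  positivity

theorem mul_conjTranspose_self_mem_accretiveCone (A : Matrix κ ι ℂ) :
    A * A.conjTranspose ∈ accretiveCone κ := by
  simpa using conjTranspose_mul_self_mem_accretiveCone A.conjTranspose

theorem trace_conjTranspose_mul_self_eq (B : Matrix ι κ ℂ) :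
    (B.conjTranspose * B).trace = ((∑ i, ∑ j, ‖B i j‖ ^ 2 : ℝ) : ℂ) := by
  simp only [Matrix.trace, Matrix.diag, Matrix.mul_apply, Matrix.conjTranspose_apply,
    RCLike.star_def, Complex.ofReal_sum, Complex.ofReal_pow]
  rw [Finset.sum_comm]
  exact Finset.sum_congr rfl fun i _ => Finset.sum_congr rfl fun j _ => Complex.conj_mul' _

variable [DecidableEq κ]

/-- Every matrix becomes accretive after adding a large multiple of the identity. -/
theorem exists_add_smul_one_mem_accretiveCone (A : Matrix κ κ ℂ) :
    ∃ c : ℝ, 0 ≤ c ∧ ∀ a, c ≤ a → a • (1 : Matrix κ κ ℂ) + A ∈ accretiveCone κ := by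
  refine ⟨‖A‖, norm_nonneg _, fun a ha ξ => ?_⟩
  have h1 : star ξ ⬝ᵥ (a • (1 : Matrix κ κ ℂ) + A).mulVec ξ
      = ((a * ∑ i, ‖ξ i‖ ^ 2 : ℝ) : ℂ) + ∑ p, ∑ q, star (ξ p) * A p q * ξ q := by
    rw [Matrix.add_mulVec, Matrix.smul_mulVec, Matrix.one_mulVec, dotProduct_add, dotProduct_smul,
      star_dotProduct_self, Complex.real_smul, Complex.ofReal_mul]
    congr 1
    simp only [dotProduct, Matrix.mulVec, Finset.mul_sum, Pi.star_apply, mul_assoc]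
  have h2 := norm_pairing_le A ξ ξ
  have h3 := (abs_le.1 (Complex.abs_re_le_norm (∑ p, ∑ q, star (ξ p) * A p q * ξ q))).1
  have h4 : ‖WithLp.toLp 2 ξ‖ * ‖WithLp.toLp 2 ξ‖ = ∑ i, ‖ξ i‖ ^ 2 := by
    rw [← sq, EuclideanSpace.norm_sq_eq]
  rw [h4] at h2
  rw [h1, Complex.add_re, Complex.ofReal_re]
  have h5 : ‖A‖ * ∑ i, ‖ξ i‖ ^ 2 ≤ a * ∑ i, ‖ξ i‖ ^ 2 := by gcongr
  linarith

/-- A real-linear functional on the complex matrices that is nonnegative on accretive matrices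
is given by a positive semidefinite density matrix. -/
theorem exists_posSemidef_of_nonneg_accretive (p : Matrix κ κ ℂ →ₗ[ℝ] ℝ)
    (hp : ∀ A ∈ accretiveCone κ, 0 ≤ p A) :
    ∃ P : Matrix κ κ ℂ, P.PosSemidef ∧ ∀ A, p A = (P * A).trace.re := by
  -- If the quadratic form of `A` is purely imaginary, both `A` and `-A` are accretive. This is what
  -- makes `P` Hermitian.
  have hskew : ∀ A : Matrix κ κ ℂ, (∀ ξ : κ → ℂ, (star ξ ⬝ᵥ A.mulVec ξ).re = 0) → p A = 0 := by
    intro A hA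
    refine le_antisymm ?_ (hp A fun ξ => (hA ξ).ge)
    have := hp (-A) fun ξ => by
      rw [Matrix.neg_mulVec, dotProduct_neg, Complex.neg_re, hA, neg_zero]
    rw [map_neg] at this
    linarith
  -- The entries are forced by `p (c E_ab) = Re (P_ba c)` at `c = 1` and `c = i`.
  set P : Matrix κ κ ℂ := Matrix.of fun b a =>
    ⟨p (Matrix.single a b 1), -p (Matrix.single a b Complex.I)⟩ with hP
  have hsingle : ∀ (a b : κ) (c : ℂ), p (Matrix.single a b c) = (P b a * c).re := by
    intro a b c
    have : Matrix.single a b c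
        = c.re • Matrix.single a b (1 : ℂ) + c.im • Matrix.single a b Complex.I := by
      rw [Matrix.smul_single, Matrix.smul_single, ← Matrix.single_add]
      congr 1
      simp [Complex.re_add_im]
    rw [this, map_add, map_smul, map_smul, Complex.mul_re]
    simp [hP]
    ring
  have htr : ∀ A, p A = (P * A).trace.re := by
    intro A
    conv_lhs => rw [Matrix.matrix_eq_sum_single A]
    simp only [map_sum, hsingle, Matrix.trace, Matrix.diag, Matrix.mul_apply, Complex.re_sum]
    rw [Finset.sum_comm]
  have hquad : ∀ (a b : κ) (c : ℂ) (ξ : κ → ℂ),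
      star ξ ⬝ᵥ (Matrix.single a b c).mulVec ξ = star (ξ a) * c * ξ b := by
    intro a b c ξ
    rw [Matrix.single_mulVec]
    simp [dotProduct, Function.update_apply, mul_assoc]
  have hherm : P.IsHermitian := by
    ext a b
    simp only [hP, Matrix.conjTranspose_apply, Matrix.of_apply]
    have h1 : p (Matrix.single a b (1 : ℂ) - Matrix.single b a 1) = 0 := by
      refine hskew _ fun ξ => ?_
      rw [Matrix.sub_mulVec, dotProduct_sub, hquad, hquad]
      simp
      ring
    have h2 : p (Matrix.single a b Complex.I + Matrix.single b a Complex.I) = 0 := by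
      refine hskew _ fun ξ => ?_
      rw [Matrix.add_mulVec, dotProduct_add, hquad, hquad]
      simp
      ring
    rw [map_sub] at h1
    rw [map_add] at h2
    refine Complex.ext ?_ ?_
    · simp; linarith
    · simp; linarith
  refine ⟨P, .of_dotProduct_mulVec_nonneg hherm fun ξ => ?_, htr⟩
  have h1 : star ξ ⬝ᵥ P.mulVec ξ = (P * Matrix.vecMulVec ξ (star ξ)).trace := by
    rw [Matrix.mul_vecMulVec, Matrix.trace_vecMulVec, dotProduct_comm]
  have h2 : 0 ≤ (star ξ ⬝ᵥ P.mulVec ξ).re := by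
    rw [h1, ← htr]
    refine hp _ fun η => ?_
    have := mul_conjTranspose_self_mem_accretiveCone (Matrix.replicateCol Unit ξ) η
    rwa [Matrix.conjTranspose_replicateCol, ← Matrix.vecMulVec_eq] at this
  have h3 : (star ξ ⬝ᵥ P.mulVec ξ).im = 0 := hherm.im_star_dotProduct_mulVec_self ξ
  exact Complex.nonneg_iff.2 ⟨h2, h3.symm⟩

/-- A positive functional on matrices is dominated, with arbitrarily small error, by a
weighted Hilbert-Schmidt norm with invertible weight. -/
theorem exists_isUnit_hilbertSchmidt_weight (p : Matrix κ κ ℂ →ₗ[ℝ] ℝ)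
    (hp : ∀ A ∈ accretiveCone κ, 0 ≤ p A) {ε : ℝ} (hε : 0 < ε) :
    ∃ S : Matrix κ κ ℂ, IsUnit S ∧
      (∀ A : Matrix κ ι ℂ, p (A * A.conjTranspose) ≤ ∑ i, ∑ j, ‖(S * A) i j‖ ^ 2) ∧
      ∑ i, ∑ j, ‖S i j‖ ^ 2 = p 1 + ε * Fintype.card κ := by
  obtain ⟨P, hP, htr⟩ := exists_posSemidef_of_nonneg_accretive p hp
  -- The density may be singular; adding `ε` makes its square-root factor invertible, at the price
  -- `ε * card κ` in the trace.
  have hpos : (P + (ε : ℂ) • (1 : Matrix κ κ ℂ)).PosDef :=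
    Matrix.PosDef.posSemidef_add hP (Matrix.PosDef.one.smul (by exact_mod_cast hε))
  obtain ⟨S, hS⟩ : ∃ S : Matrix κ κ ℂ, P + (ε : ℂ) • (1 : Matrix κ κ ℂ) = S.conjTranspose * S :=
    by
      open scoped MatrixOrder in
      exact CStarAlgebra.nonneg_iff_eq_star_mul_self.mp hpos.posSemidef.nonneg
  have hSu : IsUnit S := by
    have h := hpos.isUnit
    rw [hS, Matrix.isUnit_iff_isUnit_det, Matrix.det_mul] at h
    exact (Matrix.isUnit_iff_isUnit_det _).2 (isUnit_of_mul_isUnit_right h)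
  refine ⟨S, hSu, fun A => ?_, ?_⟩
  · have h1 : ((S * A).conjTranspose * (S * A)).trace
        = (P * (A * A.conjTranspose)).trace + ε * (A.conjTranspose * A).trace := by
      rw [Matrix.conjTranspose_mul, Matrix.mul_assoc, ← Matrix.mul_assoc S.conjTranspose, ← hS,
        Matrix.trace_mul_comm, Matrix.mul_assoc, Matrix.add_mul, Matrix.smul_mul, Matrix.one_mul,
        Matrix.trace_add, Matrix.trace_smul, smul_eq_mul, Matrix.trace_mul_comm A]
    rw [trace_conjTranspose_mul_self_eq, trace_conjTranspose_mul_self_eq] at h1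
    have h2 := congrArg Complex.re h1
    rw [Complex.add_re, ← htr, ← Complex.ofReal_mul, Complex.ofReal_re, Complex.ofReal_re] at h2
    rw [h2]
    have : 0 ≤ ε * ∑ i, ∑ j, ‖A i j‖ ^ 2 := by positivity
    linarith
  · have h1 := congrArg (fun A => A.trace.re) hS
    simp only [trace_conjTranspose_mul_self_eq, Matrix.trace_add, Matrix.trace_smul,
      Matrix.trace_one, Complex.ofReal_re, smul_eq_mul, Complex.add_re] at h1
    rw [← h1, htr 1, Matrix.mul_one, ← Complex.ofReal_natCast, ← Complex.ofReal_mul,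
      Complex.ofReal_re]

end Accretive

/-! ### Separation of a matrix from its cheap representations -/

section Duality

theorem sum_comm_pairs {ι₁ ι₂ ι₃ ι₄ M : Type*} [Fintype ι₁] [Fintype ι₂] [Fintype ι₃] [Fintype ι₄]
    [AddCommMonoid M] (f : ι₁ → ι₂ → ι₃ → ι₄ → M) :
    ∑ a, ∑ b, ∑ p, ∑ q, f a b p q = ∑ p, ∑ q, ∑ a, ∑ b, f a b p q :=
  calc ∑ a, ∑ b, ∑ p, ∑ q, f a b p q = ∑ a, ∑ p, ∑ q, ∑ b, f a b p q :=
        Finset.sum_congr rfl fun a _ => by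
          rw [Finset.sum_comm]
          exact Finset.sum_congr rfl fun p _ => Finset.sum_comm
    _ = ∑ p, ∑ a, ∑ q, ∑ b, f a b p q := Finset.sum_comm
    _ = ∑ p, ∑ q, ∑ a, ∑ b, f a b p q := Finset.sum_congr rfl fun p _ => Finset.sum_comm

/-- A polarization criterion for the Euclidean operator norm. -/
theorem norm_le_of_re_pairing_le {ι κ : Type*} [Fintype ι] [Fintype κ] [DecidableEq ι]
    [DecidableEq κ] (A : Matrix ι κ ℂ) {c : ℝ} (hc : 0 ≤ c)
    (h : ∀ (ξ : ι → ℂ) (η : κ → ℂ), (∑ p, ∑ q, star (ξ p) * A p q * η q).re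
      ≤ c * (∑ p, ‖ξ p‖ ^ 2 + ∑ q, ‖η q‖ ^ 2)) : ‖A‖ ≤ 2 * c := by
  refine norm_le_of_pairing A (by positivity) fun ξ η => ?_
  set z := ∑ p, ∑ q, star (ξ p) * A p q * η q with hz
  set a := ‖WithLp.toLp 2 ξ‖ with ha
  set b := ‖WithLp.toLp 2 η‖ with hb
  have ha0 : 0 ≤ a := norm_nonneg _
  have hb0 : 0 ≤ b := norm_nonneg _
  have ha2 : ∑ p, ‖ξ p‖ ^ 2 = a ^ 2 := (EuclideanSpace.norm_sq_eq _).symm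
  have hb2 : ∑ q, ‖η q‖ ^ 2 = b ^ 2 := (EuclideanSpace.norm_sq_eq _).symm
  rcases ha0.eq_or_lt with h0 | h0
  · have hξ : ξ = 0 := by simpa using norm_eq_zero.1 (ha.symm.trans h0.symm)
    have : z = 0 := by simp [hz, hξ]
    rw [this, norm_zero]
    positivity
  rcases hb0.eq_or_lt with h1 | h1
  · have hη : η = 0 := by simpa using norm_eq_zero.1 (hb.symm.trans h1.symm)
    have : z = 0 := by simp [hz, hη]
    rw [this, norm_zero]
    positivity
  obtain ⟨u, hu, huz⟩ : ∃ u : ℂ, ‖u‖ = 1 ∧ u * z = ‖z‖ := by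
    rcases eq_or_ne z 0 with hz0 | hz0
    · exact ⟨1, by simp, by simp [hz0]⟩
    · refine ⟨(‖z‖ : ℂ) / z, by simp [hz0], by field_simp⟩
  -- Rotating by the phase `u` makes the pairing real; the weights `b` and `a` give both vectors the
  -- norm `a * b`, the equality case of the arithmetic-geometric inequality.
  have key := h (fun p => star u * b * ξ p) (fun q => a * η q)
  have h2 : ∑ p, ∑ q, star (star u * b * ξ p) * A p q * (a * η q) = ((a * b * ‖z‖ : ℝ) : ℂ) := by
    have : ∑ p, ∑ q, star (star u * b * ξ p) * A p q * (a * η q) = a * b * (u * z) := by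
      simp only [hz, Finset.mul_sum]
      refine Finset.sum_congr rfl fun p _ => Finset.sum_congr rfl fun q _ => ?_
      simp
      ring
    rw [this, huz]
    push_cast
    ring
  rw [h2, Complex.ofReal_re] at key
  simp only [norm_mul, norm_star, hu, Complex.norm_real, Real.norm_eq_abs, mul_pow, sq_abs,
    ← Finset.mul_sum, ha2, hb2] at key
  have h3 : 0 < a * b := by positivity
  refine le_of_mul_le_mul_left ?_ h3
  nlinarith

variable {n m : ℕ} {V G : Type*} [AddCommGroup V] [Module ℂ V]

/-- The contribution of one elementary product `α · e_g · β` to a representation: the two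
weighted Gram matrices, and the product itself. -/
noncomputable def sandwichData (e : G → Matrix (Fin n) (Fin n) V) (d : G → ℝ)
    (z : G × Matrix (Fin m) (Fin n) ℂ × Matrix (Fin n) (Fin m) ℂ) :
    Matrix (Fin m) (Fin m) ℂ × Matrix (Fin m) (Fin m) ℂ × Matrix (Fin m) (Fin m) V :=
  (d z.1 • (z.2.1 * z.2.1.conjTranspose), d z.1 • (z.2.2.conjTranspose * z.2.2),
    sandwich z.2.1 (e z.1) z.2.2)

/-- All three components are quadratic in the pair of factors, so a positive scalar is absorbed by
putting its square root on each side. -/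
theorem smul_sandwichData (e : G → Matrix (Fin n) (Fin n) V) (d : G → ℝ) {c : ℝ} (hc : 0 ≤ c)
    (z : G × Matrix (Fin m) (Fin n) ℂ × Matrix (Fin n) (Fin m) ℂ) :
    sandwichData e d (z.1, (Real.sqrt c : ℂ) • z.2.1, (Real.sqrt c : ℂ) • z.2.2)
      = c • sandwichData e d z := by
  have h1 : (Real.sqrt c : ℂ) * Real.sqrt c = (c : ℂ) := by
    rw [← Complex.ofReal_mul, Real.mul_self_sqrt hc]
  refine Prod.ext ?_ (Prod.ext ?_ ?_)
  · simp only [sandwichData, Prod.smul_fst, Matrix.conjTranspose_smul, Matrix.smul_mul,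
      Matrix.mul_smul, smul_smul, RCLike.star_def, Complex.conj_ofReal, h1]
    ext i j
    simp
    ring
  · simp only [sandwichData, Prod.smul_fst, Prod.smul_snd, Matrix.conjTranspose_smul,
      Matrix.smul_mul, Matrix.mul_smul, smul_smul, RCLike.star_def, Complex.conj_ofReal, h1]
    ext i j
    simp
    ring
  · ext i j
    simp only [sandwichData, Prod.smul_snd, sandwich, Matrix.smul_apply, Matrix.of_apply,
      Finset.smul_sum, smul_eq_mul]
    refine Finset.sum_congr rfl fun p _ => Finset.sum_congr rfl fun q _ => ?_
    rw [← Complex.coe_smul, smul_smul, ← h1]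
    congr 1
    ring

/-- The cone of all triples `(∑ d αα*, ∑ d β*β, ∑ α e β)` coming from finite representations. -/
noncomputable def sandwichCone (m : ℕ) (e : G → Matrix (Fin n) (Fin n) V) (d : G → ℝ) :
    PointedCone ℝ (Matrix (Fin m) (Fin m) ℂ × Matrix (Fin m) (Fin m) ℂ ×
      Matrix (Fin m) (Fin m) V) where
  carrier := {w | ∃ l : List (G × Matrix (Fin m) (Fin n) ℂ × Matrix (Fin n) (Fin m) ℂ),
    w = (l.map (sandwichData e d)).sum}
  add_mem' := by
    rintro _ _ ⟨l, rfl⟩ ⟨l', rfl⟩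
    exact ⟨l ++ l', by simp⟩
  zero_mem' := ⟨[], rfl⟩
  smul_mem' := by
    rintro c _ ⟨l, rfl⟩
    refine ⟨l.map fun z => (z.1, (Real.sqrt c : ℂ) • z.2.1, (Real.sqrt c : ℂ) • z.2.2), ?_⟩
    rw [List.map_map, List.smul_sum, List.map_map]
    refine congrArg List.sum (List.map_congr_left fun z _ => ?_)
    exact (smul_sandwichData e d c.2 z).symm

/-- The triples dominated by a finite representation. -/
noncomputable def dominatedCone (m : ℕ) (e : G → Matrix (Fin n) (Fin n) V) (d : G → ℝ) :
    PointedCone ℝ (Matrix (Fin m) (Fin m) ℂ × Matrix (Fin m) (Fin m) ℂ ×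
      Matrix (Fin m) (Fin m) V) :=
  -- The slack is allowed only in the two Gram components; the represented matrix stays exact.
  sandwichCone m e d ⊔ (accretiveCone (Fin m)).prod ((accretiveCone (Fin m)).prod ⊥)

theorem mem_dominatedCone {e : G → Matrix (Fin n) (Fin n) V} {d : G → ℝ}
    {A B : Matrix (Fin m) (Fin m) ℂ} {v : Matrix (Fin m) (Fin m) V} :
    (A, B, v) ∈ dominatedCone m e d ↔ ∃ A' B', (A', B', v) ∈ sandwichCone m e d ∧
      A - A' ∈ accretiveCone (Fin m) ∧ B - B' ∈ accretiveCone (Fin m) := by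
  constructor
  · intro h
    obtain ⟨⟨A', B', v'⟩, h1, ⟨R, R', z⟩, h2, h3⟩ := Submodule.mem_sup.1 h
    obtain ⟨hR, hR', hz⟩ := h2
    have hz : z = 0 := hz
    simp only [Prod.mk_add_mk, Prod.mk.injEq] at h3
    obtain ⟨rfl, rfl, rfl⟩ := h3
    refine ⟨A', B', by simpa [hz] using h1, by simpa using hR, by simpa using hR'⟩
  · rintro ⟨A', B', h1, h2, h3⟩
    refine Submodule.mem_sup.2 ⟨_, h1, (A - A', B - B', 0), ⟨h2, h3, rfl⟩, by simp⟩

theorem sandwichData_mem (e : G → Matrix (Fin n) (Fin n) V) (d : G → ℝ)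
    (z : G × Matrix (Fin m) (Fin n) ℂ × Matrix (Fin n) (Fin m) ℂ) :
    sandwichData e d z ∈ sandwichCone m e d := ⟨[z], by simp⟩

theorem smul_mem_accretiveCone {c : ℝ} (hc : 0 ≤ c) {A : Matrix (Fin m) (Fin m) ℂ}
    (hA : A ∈ accretiveCone (Fin m)) : c • A ∈ accretiveCone (Fin m) :=
  (accretiveCone (Fin m)).smul_mem hc hA

theorem sandwichCone_accretive {e : G → Matrix (Fin n) (Fin n) V} {d : G → ℝ} (hd : ∀ g, 0 ≤ d g)
    {A B : Matrix (Fin m) (Fin m) ℂ} {v : Matrix (Fin m) (Fin m) V}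
    (h : (A, B, v) ∈ sandwichCone m e d) : A ∈ accretiveCone (Fin m) := by
  obtain ⟨l, hl⟩ := h
  have : A = (l.map fun z => (sandwichData e d z).1).sum := by
    have := congrArg (AddMonoidHom.fst _ _) hl
    rwa [map_list_sum, List.map_map] at this
  rw [this]
  refine list_sum_mem ?_
  simp only [List.mem_map]
  rintro _ ⟨z, -, rfl⟩
  exact smul_mem_accretiveCone (hd _) (mul_conjTranspose_self_mem_accretiveCone _)

theorem sandwich_smul_left {ι : Type*} [Fintype ι] (c : ℂ) (α : Matrix (Fin m) ι ℂ)
    (D : Matrix ι ι V) (β : Matrix ι (Fin m) ℂ) :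
    sandwich (c • α) D β = c • sandwich α D β := by
  ext i j
  simp only [sandwich, Matrix.smul_apply, Matrix.of_apply, Finset.smul_sum, smul_smul, smul_eq_mul,
    mul_assoc]

theorem sandwich_single {ι : Type*} [Fintype ι] [DecidableEq ι] (a b : Fin m) (i j : ι)
    (D : Matrix ι ι V) :
    sandwich (Matrix.single a i 1) D (Matrix.single j b 1) = Matrix.single a b (D i j) := by
  ext r s
  simp only [sandwich, Matrix.of_apply, Matrix.single_apply]
  rw [Finset.sum_eq_single i, Finset.sum_eq_single j]
  · by_cases h1 : a = r <;> by_cases h2 : b = s <;> simp [h1, h2]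
  · intro q _ hq
    simp [hq.symm]
  · simp
  · intro p _ hp
    simp [hp.symm]
  · simp

theorem sandwich_one (v : Matrix (Fin m) (Fin m) V) : sandwich 1 v 1 = v := by
  ext a b
  simp [sandwich, Matrix.one_apply]

/-- If the entries of the `e_g` span `V`, then every matrix over `V` has a representation. -/
theorem exists_mem_sandwichCone {e : G → Matrix (Fin n) (Fin n) V} {d : G → ℝ}
    (hspan : Submodule.span ℂ {w | ∃ g p q, w = e g p q} = ⊤) (v : Matrix (Fin m) (Fin m) V) :
    ∃ A B, (A, B, v) ∈ sandwichCone m e d := by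
  have hadd : ∀ v w : Matrix (Fin m) (Fin m) V, (∃ A B, (A, B, v) ∈ sandwichCone m e d) →
      (∃ A B, (A, B, w) ∈ sandwichCone m e d) → ∃ A B, (A, B, v + w) ∈ sandwichCone m e d := by
    rintro v w ⟨A, B, h⟩ ⟨A', B', h'⟩
    exact ⟨A + A', B + B', (sandwichCone m e d).add_mem h h'⟩
  have hzero : ∃ A B, (A, B, (0 : Matrix (Fin m) (Fin m) V)) ∈ sandwichCone m e d :=
    ⟨0, 0, (sandwichCone m e d).zero_mem⟩
  have hsingle : ∀ (a b : Fin m) (w : V), ∃ A B,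
      (A, B, Matrix.single a b w) ∈ sandwichCone m e d := by
    intro a b w
    have hw : w ∈ Submodule.span ℂ {w | ∃ g p q, w = e g p q} := hspan ▸ Submodule.mem_top
    have key : ∀ c : ℂ, ∃ A B, (A, B, c • Matrix.single a b w) ∈ sandwichCone m e d := by
      induction hw using Submodule.span_induction with
      | mem w hw =>
        obtain ⟨g, p, q, rfl⟩ := hw
        intro c
        rw [← sandwich_single, ← sandwich_smul_left]
        exact ⟨_, _, sandwichData_mem e d (g, _, _)⟩
      | zero => simpa using hzero
      | add x y _ _ hx hy =>
        intro c
        rw [Matrix.single_add, smul_add]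
        exact hadd _ _ (hx c) (hy c)
      | smul c' x _ hx =>
        intro c
        rw [← Matrix.smul_single, smul_smul]
        exact hx _
    simpa using key 1
  rw [Matrix.matrix_eq_sum_single v]
  refine Finset.sum_induction _ (fun v => ∃ A B, (A, B, v) ∈ sandwichCone m e d) hadd hzero
    fun a _ => ?_
  exact Finset.sum_induction _ (fun v => ∃ A B, (A, B, v) ∈ sandwichCone m e d) hadd hzero
    fun b _ => hsingle a b _

/-- Separation of a matrix from the representations of smaller cost. -/
theorem exists_separating_functionals {e : G → Matrix (Fin n) (Fin n) V} {d : G → ℝ}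
    (hd : ∀ g, 0 ≤ d g) (hspan : Submodule.span ℂ {w | ∃ g p q, w = e g p q} = ⊤)
    (hm : 0 < m) (μ : Matrix (Fin m) (Fin m) V) {t : ℝ} (ht : 0 ≤ t)
    (hμ : (t • (1 : Matrix (Fin m) (Fin m) ℂ), t • (1 : Matrix (Fin m) (Fin m) ℂ), μ)
      ∉ dominatedCone m e d) :
    ∃ (p q : Matrix (Fin m) (Fin m) ℂ →ₗ[ℝ] ℝ) (F : Matrix (Fin m) (Fin m) V →ₗ[ℝ] ℝ),
      (∀ A ∈ accretiveCone (Fin m), 0 ≤ p A) ∧ (∀ A ∈ accretiveCone (Fin m), 0 ≤ q A) ∧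
      (∀ g (α : Matrix (Fin m) (Fin n) ℂ) (β : Matrix (Fin n) (Fin m) ℂ),
        F (sandwich α (e g) β)
          ≤ d g * (p (α * α.conjTranspose) + q (β.conjTranspose * β))) ∧
      p 1 + q 1 = 1 ∧ F μ = t := by
  set one : Matrix (Fin m) (Fin m) ℂ := 1 with hone
  have hone_acc : one ∈ accretiveCone (Fin m) := by
    simpa using conjTranspose_mul_self_mem_accretiveCone (1 : Matrix (Fin m) (Fin m) ℂ)
  have hone_entry : ∀ (c : ℝ), c • one ∈ accretiveCone (Fin m) → 0 ≤ c := by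
    intro c hc
    have := hc (Pi.single ⟨0, hm⟩ 1)
    rw [hone, Matrix.smul_mulVec, Matrix.one_mulVec, dotProduct_smul, star_dotProduct_self,
      Finset.sum_eq_single ⟨0, hm⟩] at this
    · simpa using this
    · intro b _ hb
      simp [hb]
    · simp
  have hμ0 : μ ≠ 0 := by
    rintro rfl
    refine hμ (mem_dominatedCone.2 ⟨0, 0, (sandwichCone m e d).zero_mem, ?_, ?_⟩) <;>
    · rw [sub_zero]
      exact smul_mem_accretiveCone ht hone_acc
  -- The plane spanned by `(1, 1, 0)` and `(0, 0, μ)`, on which the functional `a - t b` is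
  -- prescribed.
  let L : ℝ × ℝ →ₗ[ℝ] Matrix (Fin m) (Fin m) ℂ × Matrix (Fin m) (Fin m) ℂ ×
      Matrix (Fin m) (Fin m) V :=
    (LinearMap.fst ℝ ℝ ℝ).smulRight (one, one, 0) + (LinearMap.snd ℝ ℝ ℝ).smulRight (0, 0, μ)
  have hL : ∀ a b, L (a, b) = (a • one, a • one, b • μ) := by
    intro a b
    simp [L]
  have hLinj : Function.Injective L := by
    rw [← LinearMap.ker_eq_bot, LinearMap.ker_eq_bot']
    rintro ⟨a, b⟩ hab
    rw [hL] at hab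
    simp only [Prod.mk_eq_zero] at hab
    obtain ⟨h1, -, h3⟩ := hab
    refine Prod.ext (le_antisymm ?_ (hone_entry a (h1 ▸ (accretiveCone _).zero_mem))) ?_
    · have := hone_entry (-a) (by rw [neg_smul, h1, neg_zero]; exact (accretiveCone _).zero_mem)
      simpa using this
    · exact (smul_eq_zero.1 h3).resolve_right hμ0
  let f : Matrix (Fin m) (Fin m) ℂ × Matrix (Fin m) (Fin m) ℂ × Matrix (Fin m) (Fin m) V
      →ₗ.[ℝ] ℝ :=
    ⟨LinearMap.range L, (LinearMap.fst ℝ ℝ ℝ - t • LinearMap.snd ℝ ℝ ℝ) ∘ₗ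
      (LinearEquiv.ofInjective L hLinj).symm.toLinearMap⟩
  have hf : ∀ a b, f ⟨L (a, b), LinearMap.mem_range_self _ _⟩ = a - t * b := by
    intro a b
    have : (LinearEquiv.ofInjective L hLinj).symm ⟨L (a, b), LinearMap.mem_range_self _ _⟩
        = (a, b) := (LinearEquiv.ofInjective L hLinj).symm_apply_apply (a, b)
    change (LinearMap.fst ℝ ℝ ℝ - t • LinearMap.snd ℝ ℝ ℝ) _ = _
    erw [this]
    simp
  obtain ⟨g, hgf, hgs⟩ := riesz_extension (dominatedCone m e d) f (by
      -- Positivity of `a - t b` on the cone. For `b ≤ 0`, accretivity of the Gram component gives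
      -- `a ≥ 0`. For `b > 0`, divide by `b`: if `a / b < t`, raising it to `t` would put the
      -- excluded triple in the cone.
      rintro ⟨_, ⟨a, b⟩, rfl⟩ hmem
      rw [hf]
      change L (a, b) ∈ _ at hmem
      rw [hL] at hmem
      obtain ⟨A', B', h1, h2, h3⟩ := mem_dominatedCone.1 hmem
      rcases le_or_gt b 0 with hb | hb
      · have ha : 0 ≤ a := hone_entry a (by
          simpa using (accretiveCone _).add_mem h2 (sandwichCone_accretive hd h1))
        nlinarith
      · by_contra! hlt
        have hlt : b⁻¹ * a < t := by
          rw [inv_mul_lt_iff₀ hb]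
          linarith
        have hs := (dominatedCone m e d).smul_mem (inv_nonneg.2 hb.le) hmem
        have hs : b⁻¹ • (a • one, a • one, b • μ) ∈ dominatedCone m e d := hs
        rw [Prod.smul_mk, Prod.smul_mk, smul_smul, smul_smul, inv_mul_cancel₀ hb.ne',
          one_smul] at hs
        obtain ⟨A', B', h1, h2, h3⟩ := mem_dominatedCone.1 hs
        have h4 := smul_mem_accretiveCone (sub_pos.2 hlt).le hone_acc
        refine hμ (mem_dominatedCone.2 ⟨A', B', h1, ?_, ?_⟩)
        · convert (accretiveCone _).add_mem h4 h2 using 1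
          rw [sub_smul]
          abel
        · convert (accretiveCone _).add_mem h4 h3 using 1
          rw [sub_smul]
          abel) (by
      -- Cofinality of the plane: represent `v` somehow, then a large multiple of `(1, 1, 0)`
      -- dominates the resulting Gram matrices.
      rintro ⟨A, B, v⟩
      obtain ⟨A', B', h⟩ := exists_mem_sandwichCone (d := d) hspan v
      obtain ⟨c, -, hc⟩ := exists_add_smul_one_mem_accretiveCone (A - A')
      obtain ⟨c', -, hc'⟩ := exists_add_smul_one_mem_accretiveCone (B - B')
      refine ⟨⟨L (max c c', 0), LinearMap.mem_range_self _ _⟩, ?_⟩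
      change L (max c c', 0) + _ ∈ _
      rw [hL, zero_smul, Prod.mk_add_mk, Prod.mk_add_mk, zero_add]
      refine mem_dominatedCone.2 ⟨A', B', h, ?_, ?_⟩
      · rw [add_sub_assoc]
        exact hc _ (le_max_left _ _)
      · rw [add_sub_assoc]
        exact hc' _ (le_max_right _ _))
  have hgL : ∀ a b, g (a • one, a • one, b • μ) = a - t * b := by
    intro a b
    rw [← hL, ← hf]
    exact hgf ⟨L (a, b), LinearMap.mem_range_self _ _⟩
  have hsplit : ∀ A B v, g (A, B, v) = g (A, 0, 0) + g (0, B, 0) + g (0, 0, v) := by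
    intro A B v
    rw [← map_add, ← map_add]
    simp
  -- The sign on the third component turns positivity of `g` on elementary triples into an upper
  -- bound for `F`.
  refine ⟨g ∘ₗ LinearMap.inl ℝ _ _, g ∘ₗ LinearMap.inr ℝ _ _ ∘ₗ LinearMap.inl ℝ _ _,
    -(g ∘ₗ LinearMap.inr ℝ _ _ ∘ₗ LinearMap.inr ℝ _ _), fun A hA => ?_, fun A hA => ?_,
    fun i α β => ?_, ?_, ?_⟩
  · refine hgs _ (mem_dominatedCone.2 ⟨0, 0, (sandwichCone m e d).zero_mem, ?_, ?_⟩)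
    · simpa using hA
    · simp
  · refine hgs _ (mem_dominatedCone.2 ⟨0, 0, (sandwichCone m e d).zero_mem, ?_, ?_⟩)
    · simp
    · simpa using hA
  · have h1 := hgs _ (Submodule.mem_sup_left (sandwichData_mem e d (i, α, β)))
    rw [sandwichData, hsplit] at h1
    have h2 : g (d i • (α * α.conjTranspose), 0, 0) = d i * g (α * α.conjTranspose, 0, 0) := by
      rw [← smul_eq_mul, ← map_smul]
      simp
    have h3 : g (0, d i • (β.conjTranspose * β), 0) = d i * g (0, β.conjTranspose * β, 0) := by
      rw [← smul_eq_mul, ← map_smul]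
      simp
    simp only [h2, h3] at h1
    simp only [LinearMap.neg_apply, LinearMap.comp_apply, LinearMap.inl_apply,
      LinearMap.inr_apply]
    rw [mul_add]
    change -g (0, 0, _) ≤ d i * g (_, 0, 0) + d i * g (0, _, 0)
    linarith
  · have h1 := hgL 1 0
    rw [one_smul, zero_smul, hsplit] at h1
    change g (one, 0, 0) + g (0, one, 0) = 1
    have h2 : g (0, 0, 0) = 0 := map_zero g
    linarith
  · have h1 := hgL 0 1
    rw [one_smul, zero_smul] at h1
    change -g (0, 0, μ) = t
    linarith

/-- The matrix `[φ(v_pq)]` of a matrix-valued linear map, as a scalar matrix. -/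
def ampMatrix {ι : Type*} (φ : V →ₗ[ℂ] Matrix (Fin m) (Fin m) ℂ) (v : Matrix ι ι V) :
    Matrix (ι × Fin m) (ι × Fin m) ℂ :=
  Matrix.of fun p q => φ (v p.1 q.1) p.2 q.2

theorem pairing_ampMatrix {ι : Type*} [Fintype ι] (φ : V →ₗ[ℂ] Matrix (Fin m) (Fin m) ℂ)
    (v : Matrix ι ι V) (ξ η : ι × Fin m → ℂ) :
    ∑ p, ∑ q, star (ξ p) * ampMatrix φ v p q * η q
      = ∑ p, ∑ q, (fun r => star (ξ (p, r))) ⬝ᵥ (φ (v p q)).mulVec fun s => η (q, s) := by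
  simp only [Fintype.sum_prod_type, ampMatrix, Matrix.of_apply, dotProduct, Matrix.mulVec,
    Finset.mul_sum, mul_assoc]
  exact Finset.sum_congr rfl fun p _ => Finset.sum_comm

/-- Evaluation of a functional on a product `α · D · β` through a factorization
`F_ab = ∑ S_ra φ_rs T_bs` of its coordinate functionals. -/
theorem functional_sandwich {ι : Type*} [Fintype ι] (F : Matrix (Fin m) (Fin m) V →ₗ[ℂ] ℂ)
    (φ : V →ₗ[ℂ] Matrix (Fin m) (Fin m) ℂ) (S T : Matrix (Fin m) (Fin m) ℂ)
    (h : ∀ a b w, F (Matrix.single a b w) = (S.transpose * φ w * T.transpose) a b)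
    (α : Matrix (Fin m) ι ℂ) (D : Matrix ι ι V) (β : Matrix ι (Fin m) ℂ) :
    F (sandwich α D β) = ∑ p, ∑ q, (fun r => (S * α) r p) ⬝ᵥ
      (φ (D p q)).mulVec fun s => (β * T) q s := by
  have h0 : ∀ v, F v = ∑ a, ∑ b, (S.transpose * φ (v a b) * T.transpose) a b := by
    intro v
    conv_lhs => rw [Matrix.matrix_eq_sum_single v]
    simp only [map_sum, h]
  rw [h0]
  simp only [sandwich, Matrix.of_apply]
  have h1 : ∀ a b, (S.transpose * φ (∑ p, ∑ q, (α a p * β q b) • D p q) * T.transpose) a b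
      = ∑ p, ∑ q, α a p * ((S.transpose * φ (D p q) * T.transpose) a b * β q b) := by
    intro a b
    simp only [map_sum, map_smul, Matrix.mul_sum, Matrix.sum_mul, Matrix.mul_smul,
      Matrix.smul_mul, Matrix.sum_apply, Matrix.smul_apply, smul_eq_mul]
    refine Finset.sum_congr rfl fun p _ => Finset.sum_congr rfl fun q _ => ?_
    ring
  simp only [h1]
  rw [sum_comm_pairs]
  refine Finset.sum_congr rfl fun p _ => Finset.sum_congr rfl fun q _ => ?_
  have h2 : ∑ a, ∑ b, α a p * ((S.transpose * φ (D p q) * T.transpose) a b * β q b)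
      = (fun a => α a p) ⬝ᵥ (S.transpose * φ (D p q) * T.transpose).mulVec fun b => β q b := by
    simp only [dotProduct, Matrix.mulVec, Finset.mul_sum]
  rw [h2, ← Matrix.mulVec_mulVec, ← Matrix.mulVec_mulVec, Matrix.dotProduct_mulVec,
    Matrix.vecMul_transpose]
  congr 2
  ext s
  simp [Matrix.mulVec, dotProduct, Matrix.mul_apply, mul_comm]

/-- Duality between representations and completely contractive matrix-valued maps: if every
linear map `φ : V → M_m` with `‖[φ(e_g)]‖ ≤ d_g` for all `g` satisfies `‖[φ(μ)]‖ ≤ C`, then `μ`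
is dominated by representations of every cost larger than `C`. -/
theorem mem_dominatedCone_of_forall_norm_le {e : G → Matrix (Fin n) (Fin n) V} {d : G → ℝ}
    (hd : ∀ g, 0 ≤ d g) (hspan : Submodule.span ℂ {w | ∃ g p q, w = e g p q} = ⊤)
    (hm : 0 < m) (μ : Matrix (Fin m) (Fin m) V) {C t : ℝ} (hC : 0 ≤ C) (hCt : C < t)
    (hμ : ∀ φ : V →ₗ[ℂ] Matrix (Fin m) (Fin m) ℂ, (∀ g, ‖ampMatrix φ (e g)‖ ≤ d g) →
      ‖ampMatrix φ μ‖ ≤ C) :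
    (t • (1 : Matrix (Fin m) (Fin m) ℂ), t • (1 : Matrix (Fin m) (Fin m) ℂ), μ)
      ∈ dominatedCone m e d := by
  by_contra hnot
  obtain ⟨p, q, F, hp, hq, hF, hpq, hFμ⟩ :=
    exists_separating_functionals hd hspan hm μ (hC.trans hCt.le) hnot
  obtain ⟨ε, hε, hεt⟩ : ∃ ε : ℝ, 0 < ε ∧ C * (1 + 2 * ε * m) < t := by
    refine ⟨(t - C) / (2 * m * C + 1) / 2, by have := sub_pos.2 hCt; positivity, ?_⟩
    have h1 : 0 < 2 * m * C + 1 := by positivity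
    have h2 : (t - C) / (2 * m * C + 1) / 2 * (2 * m * C + 1) = (t - C) / 2 := by
      field_simp
    have h3 : 0 < (t - C) / (2 * m * C + 1) / 2 := by have := sub_pos.2 hCt; positivity
    nlinarith
  obtain ⟨S, hSu, hS, hS1⟩ := exists_isUnit_hilbertSchmidt_weight (ι := Fin n) p hp hε
  obtain ⟨T, hTu, hT, hT1⟩ := exists_isUnit_hilbertSchmidt_weight (ι := Fin n) q hq hε
  rw [Fintype.card_fin] at hS1 hT1
  have hSdet := (Matrix.isUnit_iff_isUnit_det S).1 hSu
  have hTdet := (Matrix.isUnit_iff_isUnit_det T).1 hTu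
  -- The bound for `q (β*β)` is `‖Tβ*‖²`, which equals `‖β T*‖²`, so the weight acts on `β` from the
  -- right through `T*`.
  set U : Matrix (Fin m) (Fin m) ℂ := T.conjTranspose with hU
  have hUdet : IsUnit U.det := by
    rw [hU, Matrix.det_conjTranspose]
    exact hTdet.star
  have hUdet' : IsUnit U.transpose.det := by rwa [Matrix.det_transpose]
  have hSdet' : IsUnit S.transpose.det := by rwa [Matrix.det_transpose]
  set Fc : Matrix (Fin m) (Fin m) V →ₗ[ℂ] ℂ := Module.Dual.extendRCLike F with hFc
  have hre : ∀ v, (Fc v).re = F v := fun v => Module.Dual.re_extendRCLike_apply (𝕜 := ℂ) F v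
  -- The coordinate functionals of `Fc` with both weights divided out.
  let φ : V →ₗ[ℂ] Matrix (Fin m) (Fin m) ℂ :=
    { toFun := fun w => S.transpose⁻¹ * (Matrix.of fun a b => Fc (Matrix.single a b w))
        * U.transpose⁻¹
      map_add' := by
        intro v w
        rw [← Matrix.add_mul, ← Matrix.mul_add]
        congr 2
        ext a b
        simp [Matrix.single_add]
      map_smul' := by
        intro c w
        rw [RingHom.id_apply, ← Matrix.smul_mul, ← Matrix.mul_smul]
        congr 2
        ext a b
        simp [← Matrix.smul_single] }
  have hφ : ∀ a b w, Fc (Matrix.single a b w) = (S.transpose * φ w * U.transpose) a b := by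
    intro a b w
    have : S.transpose * φ w * U.transpose = Matrix.of fun a b => Fc (Matrix.single a b w) := by
      change S.transpose * (S.transpose⁻¹ * (Matrix.of fun a b => Fc (Matrix.single a b w))
        * U.transpose⁻¹) * U.transpose = _
      rw [← Matrix.mul_assoc, ← Matrix.mul_assoc, Matrix.mul_nonsing_inv _ hSdet', Matrix.one_mul,
        Matrix.mul_assoc, Matrix.nonsing_inv_mul _ hUdet', Matrix.mul_one]
    rw [this, Matrix.of_apply]
  have hφe : ∀ g, ‖ampMatrix φ (e g)‖ ≤ 2 * d g := by
    intro g
    refine norm_le_of_re_pairing_le _ (hd g) fun ξ η => ?_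
    set x : Matrix (Fin m) (Fin n) ℂ := Matrix.of fun r p => star (ξ (p, r)) with hx
    set y : Matrix (Fin n) (Fin m) ℂ := Matrix.of fun q s => η (q, s) with hy
    -- These factors cancel the weights, so the bound on `F` involves only the Euclidean norms of
    -- `ξ` and `η`.
    have h1 := hF g (S⁻¹ * x) (y * U⁻¹)
    rw [← hre, functional_sandwich Fc φ S U hφ, ← Matrix.mul_assoc, Matrix.mul_nonsing_inv _ hSdet,
      Matrix.one_mul, Matrix.mul_assoc, Matrix.nonsing_inv_mul _ hUdet, Matrix.mul_one] at h1
    rw [pairing_ampMatrix]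
    refine h1.trans (mul_le_mul_of_nonneg_left (add_le_add ?_ ?_) (hd g))
    · refine (hS _).trans (le_of_eq ?_)
      rw [← Matrix.mul_assoc, Matrix.mul_nonsing_inv _ hSdet, Matrix.one_mul,
        Fintype.sum_prod_type, Finset.sum_comm]
      simp [hx]
    · have h2 := hT (y * U⁻¹).conjTranspose
      rw [Matrix.conjTranspose_conjTranspose] at h2
      refine h2.trans (le_of_eq ?_)
      have h3 : T * (y * U⁻¹).conjTranspose = y.conjTranspose := by
        rw [← Matrix.conjTranspose_conjTranspose T, ← Matrix.conjTranspose_mul, ← hU,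
          Matrix.mul_assoc, Matrix.nonsing_inv_mul _ hUdet, Matrix.mul_one]
      rw [h3, Fintype.sum_prod_type, Finset.sum_comm]
      simp [hy]
  have hhalf : ∀ {ι : Type} [Fintype ι] [DecidableEq ι] (v : Matrix ι ι V),
      ‖ampMatrix ((1 / 2 : ℂ) • φ) v‖ = 1 / 2 * ‖ampMatrix φ v‖ := by
    intro ι _ _ v
    have : ampMatrix ((1 / 2 : ℂ) • φ) v = (1 / 2 : ℂ) • ampMatrix φ v := rfl
    rw [this, norm_smul]
    norm_num
  have hφμ : ‖ampMatrix φ μ‖ ≤ 2 * C := by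
    have := hμ ((1 / 2 : ℂ) • φ) fun g => by
      rw [hhalf]
      linarith [hφe g]
    rw [hhalf] at this
    linarith
  -- Writing `μ = 1 · μ · 1` leaves the weights themselves as the two vectors paired with `φ(μ)`.
  have h1 : F μ = (∑ i, ∑ j, star (star (S i.2 i.1)) * ampMatrix φ μ i j * U j.1 j.2).re := by
    rw [← hre, ← sandwich_one μ, functional_sandwich Fc φ S U hφ, Matrix.mul_one, Matrix.one_mul,
      sandwich_one, pairing_ampMatrix φ μ (fun i => star (S i.2 i.1)) fun j => U j.1 j.2]
    simp only [star_star]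
  have h2 := norm_pairing_le (ampMatrix φ μ) (fun i => star (S i.2 i.1)) fun j => U j.1 j.2
  have h3 := (Complex.re_le_norm _).trans h2
  rw [← h1, hFμ] at h3
  have h4 : ‖WithLp.toLp 2 (fun i : Fin m × Fin m => star (S i.2 i.1))‖ ^ 2 = p 1 + ε * m := by
    rw [EuclideanSpace.norm_sq_eq, ← hS1, Fintype.sum_prod_type, Finset.sum_comm]
    simp
  have h5 : ‖WithLp.toLp 2 (fun i : Fin m × Fin m => U i.1 i.2)‖ ^ 2 = q 1 + ε * m := by
    rw [EuclideanSpace.norm_sq_eq, ← hT1, Fintype.sum_prod_type, Finset.sum_comm]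
    simp [hU]
  set a := ‖WithLp.toLp 2 (fun i : Fin m × Fin m => star (S i.2 i.1))‖
  set b := ‖WithLp.toLp 2 (fun i : Fin m × Fin m => U i.1 i.2)‖
  -- Here `a² + b² = p 1 + q 1 + 2εm = 1 + 2εm`; the resulting half cancels the factor 2 in `hφμ`.
  have h6 : a * b ≤ (1 + 2 * ε * m) / 2 := by nlinarith [sq_nonneg (a - b)]
  have h7 : 0 ≤ a * b := by positivity
  have h8 : ‖ampMatrix φ μ‖ * (a * b) ≤ 2 * C * ((1 + 2 * ε * m) / 2) :=
    mul_le_mul hφμ h6 h7 (by positivity)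
  linarith

end Duality

/-! ### Norms of block-diagonal products and reassembly of representations -/

section Norms

theorem norm_submatrix_equiv_le {ι κ ι' κ' : Type*} [Fintype ι] [Fintype κ] [Fintype ι']
    [Fintype κ'] [DecidableEq ι] [DecidableEq κ] [DecidableEq ι'] [DecidableEq κ']
    (A : Matrix ι κ ℂ) (e : ι' ≃ ι) (e' : κ' ≃ κ) : ‖A.submatrix e e'‖ ≤ ‖A‖ := by
  refine norm_le_of_pairing _ (norm_nonneg _) fun ξ η => ?_
  have h := norm_pairing_le A (fun p => ξ (e.symm p)) fun q => η (e'.symm q)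
  have hξ : ‖WithLp.toLp 2 fun p => ξ (e.symm p)‖ = ‖WithLp.toLp 2 ξ‖ := by
    rw [EuclideanSpace.norm_eq, EuclideanSpace.norm_eq]
    congr 1
    exact Equiv.sum_comp e.symm fun p => ‖ξ p‖ ^ 2
  have hη : ‖WithLp.toLp 2 fun q => η (e'.symm q)‖ = ‖WithLp.toLp 2 η‖ := by
    rw [EuclideanSpace.norm_eq, EuclideanSpace.norm_eq]
    congr 1
    exact Equiv.sum_comp e'.symm fun q => ‖η q‖ ^ 2
  rw [hξ, hη] at h
  refine le_trans (le_of_eq ?_) h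
  congr 1
  rw [← Equiv.sum_comp e]
  refine Finset.sum_congr rfl fun p _ => ?_
  rw [← Equiv.sum_comp e']
  simp

theorem norm_submatrix_equiv {ι κ ι' κ' : Type*} [Fintype ι] [Fintype κ] [Fintype ι']
    [Fintype κ'] [DecidableEq ι] [DecidableEq κ] [DecidableEq ι'] [DecidableEq κ']
    (A : Matrix ι κ ℂ) (e : ι' ≃ ι) (e' : κ' ≃ κ) : ‖A.submatrix e e'‖ = ‖A‖ := by
  refine le_antisymm (norm_submatrix_equiv_le A e e') ?_
  simpa using norm_submatrix_equiv_le (A.submatrix e e') e.symm e'.symm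

/-- The pairing splits over the blocks, and Cauchy-Schwarz over the block index recombines the norms
of the slices. -/
theorem norm_blockDiagonal_le {ι κ o : Type*} [Fintype ι] [Fintype κ] [Fintype o]
    [DecidableEq ι] [DecidableEq κ] [DecidableEq o] (A : o → Matrix ι κ ℂ) {C : ℝ} (hC : 0 ≤ C)
    (h : ∀ l, ‖A l‖ ≤ C) : ‖Matrix.blockDiagonal A‖ ≤ C := by
  refine norm_le_of_pairing _ hC fun ξ η => ?_
  have h1 : ∑ p, ∑ q, star (ξ p) * Matrix.blockDiagonal A p q * η q
      = ∑ l, ∑ i, ∑ j, star (ξ (i, l)) * A l i j * η (j, l) := by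
    simp only [Fintype.sum_prod_type, Matrix.blockDiagonal_apply, mul_ite, ite_mul, mul_zero,
      zero_mul, Finset.sum_ite_eq, Finset.mem_univ, if_true]
    exact Finset.sum_comm
  have hsl : ∀ {ι : Type _} [Fintype ι] (ζ : ι × o → ℂ),
      ∑ l, ‖WithLp.toLp 2 fun i => ζ (i, l)‖ ^ 2 = ‖WithLp.toLp 2 ζ‖ ^ 2 := by
    intro ι _ ζ
    simp only [EuclideanSpace.norm_sq_eq, Fintype.sum_prod_type]
    exact Finset.sum_comm
  have hsl' : ∑ l, ‖WithLp.toLp 2 fun j => η (j, l)‖ ^ 2 = ‖WithLp.toLp 2 η‖ ^ 2 := by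
    simp only [EuclideanSpace.norm_sq_eq, Fintype.sum_prod_type]
    exact Finset.sum_comm
  rw [h1]
  refine (norm_sum_le _ _).trans ?_
  calc ∑ l, ‖∑ i, ∑ j, star (ξ (i, l)) * A l i j * η (j, l)‖
      ≤ ∑ l, C * (‖WithLp.toLp 2 fun i => ξ (i, l)‖ * ‖WithLp.toLp 2 fun j => η (j, l)‖) :=
        Finset.sum_le_sum fun l _ =>
          (norm_pairing_le (A l) (fun i => ξ (i, l)) fun j => η (j, l)).trans
            (mul_le_mul_of_nonneg_right (h l) (by positivity))
    _ ≤ C * (‖WithLp.toLp 2 ξ‖ * ‖WithLp.toLp 2 η‖) := by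
        rw [← Finset.mul_sum]
        refine mul_le_mul_of_nonneg_left ?_ hC
        refine (Real.sum_mul_le_sqrt_mul_sqrt _ _ _).trans (le_of_eq ?_)
        rw [hsl ξ, hsl', Real.sqrt_sq (norm_nonneg _), Real.sqrt_sq (norm_nonneg _)]

theorem norm_le_sqrt_of_accretive {ι κ : Type*} [Fintype ι] [Fintype κ] [DecidableEq ι]
    [DecidableEq κ] (B : Matrix ι κ ℂ) {t : ℝ} (ht : 0 ≤ t)
    (h : t • (1 : Matrix κ κ ℂ) - B.conjTranspose * B ∈ accretiveCone κ) : ‖B‖ ≤ Real.sqrt t := by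
  rw [Matrix.l2_opNorm_def]
  refine ContinuousLinearMap.opNorm_le_bound _ (Real.sqrt_nonneg _) fun v => ?_
  change ‖WithLp.toLp 2 (B.mulVec v.ofLp)‖ ≤ Real.sqrt t * ‖v‖
  refine (sq_le_sq₀ (norm_nonneg _) (by positivity)).1 ?_
  rw [mul_pow, Real.sq_sqrt ht, EuclideanSpace.norm_sq_eq, EuclideanSpace.norm_sq_eq]
  have h1 := h v.ofLp
  rw [Matrix.sub_mulVec, dotProduct_sub, Matrix.smul_mulVec, Matrix.one_mulVec, dotProduct_smul,
    ← Matrix.mulVec_mulVec, Matrix.dotProduct_mulVec _ B.conjTranspose, ← Matrix.star_mulVec,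
    star_dotProduct_self, star_dotProduct_self, Complex.sub_re, Complex.smul_re,
    Complex.ofReal_re, Complex.ofReal_re, smul_eq_mul] at h1
  exact sub_nonneg.1 h1

variable {m k : ℕ} {V : Type*} [AddCommGroup V] [Module ℂ V]

theorem sandwich_apply_of_linear {ι : Type*} [Fintype ι] {W : Type*} [AddCommGroup W] [Module ℂ W]
    (φ : V →ₗ[ℂ] W) (α : Matrix (Fin m) ι ℂ) (D : Matrix ι ι V) (β : Matrix ι (Fin m) ℂ) :
    (sandwich α D β).map φ = sandwich α (D.map φ) β := by
  ext a b
  simp [sandwich]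

/-- With the index of `M_k` placed last, `α ⊗ 1` is block-diagonal with `k` copies of `α`, so
amplification commutes with scalar factors. -/
theorem ampMatrix_sandwich {ι : Type*} [Fintype ι] (φ : V →ₗ[ℂ] Matrix (Fin k) (Fin k) ℂ)
    (α : Matrix (Fin m) ι ℂ) (D : Matrix ι ι V) (β : Matrix ι (Fin m) ℂ) :
    ampMatrix φ (sandwich α D β) = Matrix.blockDiagonal (fun _ : Fin k => α) * ampMatrix φ D *
      Matrix.blockDiagonal (fun _ : Fin k => β) := by
  ext ⟨a, r⟩ ⟨b, s⟩
  simp only [ampMatrix, sandwich, Matrix.of_apply, map_sum, map_smul, Matrix.sum_apply,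
    Matrix.smul_apply, smul_eq_mul, Matrix.mul_apply, Matrix.blockDiagonal_apply,
    Fintype.sum_prod_type, ite_mul, mul_ite, zero_mul, mul_zero, Finset.sum_ite_eq,
    Finset.sum_ite_eq', Finset.mem_univ, if_true, Finset.sum_mul]
  rw [Finset.sum_comm]
  refine Finset.sum_congr rfl fun p _ => Finset.sum_congr rfl fun q _ => ?_
  ring

/-- Completely bounded estimate for a product of a block-diagonal matrix with scalar matrices. -/
theorem norm_ampMatrix_sandwich_blockDiagonal_le {n N : ℕ}
    (φ : V →ₗ[ℂ] Matrix (Fin k) (Fin k) ℂ) (α : Matrix (Fin m) (Fin n × Fin N) ℂ)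
    (D : Fin N → Matrix (Fin n) (Fin n) V) (β : Matrix (Fin n × Fin N) (Fin m) ℂ) {C : ℝ}
    (hC : 0 ≤ C) (h : ∀ l, ‖ampMatrix φ (D l)‖ ≤ C) :
    ‖ampMatrix φ (sandwich α (Matrix.blockDiagonal D) β)‖ ≤ ‖α‖ * ‖β‖ * C := by
  rw [ampMatrix_sandwich]
  have h1 : ‖ampMatrix φ (Matrix.blockDiagonal D)‖ ≤ C := by
    let σ : (Fin n × Fin N) × Fin k ≃ (Fin n × Fin k) × Fin N :=
      ⟨fun p => ((p.1.1, p.2), p.1.2), fun p => ((p.1.1, p.2), p.1.2), fun _ => rfl, fun _ => rfl⟩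
    have h2 : ampMatrix φ (Matrix.blockDiagonal D)
        = (Matrix.blockDiagonal fun l => ampMatrix φ (D l)).submatrix σ σ := by
      ext ⟨⟨i, l⟩, r⟩ ⟨⟨j, l'⟩, s⟩
      simp only [ampMatrix, Matrix.of_apply, Matrix.submatrix_apply, Matrix.blockDiagonal_apply, σ,
        Equiv.coe_fn_mk]
      split_ifs <;> simp
    rw [h2, norm_submatrix_equiv]
    exact norm_blockDiagonal_le _ hC h
  refine (Matrix.l2_opNorm_mul _ _).trans ?_
  have h3 := norm_blockDiagonal_le (fun _ : Fin k => α) (norm_nonneg α) fun _ => le_rfl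
  have h4 := norm_blockDiagonal_le (fun _ : Fin k => β) (norm_nonneg β) fun _ => le_rfl
  calc _ ≤ (‖α‖ * C) * ‖β‖ := by
        refine mul_le_mul ((Matrix.l2_opNorm_mul _ _).trans ?_) h4 (norm_nonneg _) (by positivity)
        exact mul_le_mul h3 h1 (norm_nonneg _) (norm_nonneg _)
    _ = ‖α‖ * ‖β‖ * C := by ring

/-- A dominated triple yields a representation by a block-diagonal matrix with normalized blocks
and scalar factors of controlled norm. -/
theorem exists_blockDiagonal_representation {n : ℕ} {G : Type*} [Nonempty G]
    {e : G → Matrix (Fin n) (Fin n) V} {d : G → ℝ} (hd : ∀ g, 0 ≤ d g)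
    (hde : ∀ g, d g = 0 → e g = 0) {μ : Matrix (Fin m) (Fin m) V} {t : ℝ} (ht : 0 ≤ t)
    (h : (t • (1 : Matrix (Fin m) (Fin m) ℂ), t • (1 : Matrix (Fin m) (Fin m) ℂ), μ)
      ∈ dominatedCone m e d) :
    ∃ (N : ℕ) (_ : 0 < N) (α : Matrix (Fin m) (Fin n × Fin N) ℂ)
      (β : Matrix (Fin n × Fin N) (Fin m) ℂ) (c : Fin N → ℂ) (g : Fin N → G),
      μ = sandwich α (Matrix.blockDiagonal fun l => c l • e (g l)) β ∧
      ‖α‖ ≤ Real.sqrt t ∧ ‖β‖ ≤ Real.sqrt t ∧ ∀ l, ‖c l‖ * d (g l) ≤ 1 := by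
  obtain ⟨A, B, ⟨l₀, hl₀⟩, hA, hB⟩ := mem_dominatedCone.1 h
  obtain ⟨l, hl, hsum⟩ : ∃ l : List (G × Matrix (Fin m) (Fin n) ℂ × Matrix (Fin n) (Fin m) ℂ),
      0 < l.length ∧ (A, B, μ) = (l.map (sandwichData e d)).sum := by
    -- A zero term is prepended so that at least one block occurs.
    refine ⟨(Classical.arbitrary G, 0, 0) :: l₀, by simp, ?_⟩
    rw [List.map_cons, List.sum_cons, ← hl₀]
    have : sandwichData e d (Classical.arbitrary G, (0 : Matrix (Fin m) (Fin n) ℂ), 0) = 0 := by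
      refine Prod.ext ?_ (Prod.ext ?_ ?_)
      · simp [sandwichData]
      · simp [sandwichData]
      · ext a b
        simp [sandwichData, sandwich]
    rw [this, zero_add]
  rw [← Fin.sum_univ_fun_getElem] at hsum
  set z : Fin l.length → G × Matrix (Fin m) (Fin n) ℂ × Matrix (Fin n) (Fin m) ℂ :=
    fun i => l[i] with hz
  have hAz : A = ∑ i, d (z i).1 • ((z i).2.1 * (z i).2.1.conjTranspose) := by
    simpa [Prod.fst_sum, sandwichData, hz] using congrArg Prod.fst hsum
  have hBz : B = ∑ i, d (z i).1 • ((z i).2.2.conjTranspose * (z i).2.2) := by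
    simpa [Prod.fst_sum, Prod.snd_sum, sandwichData, hz] using congrArg (fun w => w.2.1) hsum
  have hμz : μ = ∑ i, sandwich (z i).2.1 (e (z i).1) (z i).2.2 := by
    simpa [Prod.snd_sum, sandwichData, hz] using congrArg (fun w => w.2.2) hsum
  have hsq : ∀ i, (Real.sqrt (d (z i).1) : ℂ) * Real.sqrt (d (z i).1) = (d (z i).1 : ℂ) := by
    intro i
    rw [← Complex.ofReal_mul, Real.mul_self_sqrt (hd _)]
  -- Stacking the factors scaled by `√d` makes `αα*` and `β*β` exactly the two Gram matrices; the
  -- blocks are divided by `d` in return.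
  set α : Matrix (Fin m) (Fin n × Fin l.length) ℂ :=
    Matrix.of fun a p => Real.sqrt (d (z p.2).1) * (z p.2).2.1 a p.1 with hα
  set β : Matrix (Fin n × Fin l.length) (Fin m) ℂ :=
    Matrix.of fun p b => Real.sqrt (d (z p.2).1) * (z p.2).2.2 p.1 b with hβ
  have hαA : α.conjTranspose.conjTranspose * α.conjTranspose = A := by
    rw [hAz]
    ext a b
    simp only [hα, Matrix.conjTranspose_conjTranspose, Matrix.mul_apply, Matrix.of_apply,
      Matrix.conjTranspose_apply, Fintype.sum_prod_type, Matrix.sum_apply, Matrix.smul_apply,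
      Complex.real_smul, Finset.mul_sum, star_mul', RCLike.star_def, Complex.conj_ofReal, ← hsq]
    rw [Finset.sum_comm]
    refine Finset.sum_congr rfl fun i _ => Finset.sum_congr rfl fun p _ => ?_
    ring
  have hβB : β.conjTranspose * β = B := by
    rw [hBz]
    ext a b
    simp only [hβ, Matrix.mul_apply, Matrix.of_apply,
      Matrix.conjTranspose_apply, Fintype.sum_prod_type, Matrix.sum_apply, Matrix.smul_apply,
      Complex.real_smul, Finset.mul_sum, star_mul', RCLike.star_def, Complex.conj_ofReal, ← hsq]
    rw [Finset.sum_comm]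
    refine Finset.sum_congr rfl fun i _ => Finset.sum_congr rfl fun p _ => ?_
    ring
  -- When `d = 0` the inverse is `0`, which is harmless because `e` vanishes there.
  refine ⟨l.length, hl, α, β, fun i => ((d (z i).1)⁻¹ : ℝ), fun i => (z i).1, ?_, ?_, ?_, ?_⟩
  · rw [hμz]
    ext a b
    simp only [Matrix.sum_apply, sandwich, Matrix.of_apply, Fintype.sum_prod_type,
      Matrix.blockDiagonal_apply, smul_ite, smul_zero, Finset.sum_ite_eq, Finset.mem_univ, if_true]
    rw [Finset.sum_comm]
    refine Finset.sum_congr rfl fun p _ => Finset.sum_congr rfl fun i _ =>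
      Finset.sum_congr rfl fun q _ => ?_
    rcases eq_or_ne (d (z i).1) 0 with h0 | h0
    · simp [hde _ h0]
    · rw [Matrix.smul_apply, smul_smul]
      congr 1
      have : (d (z i).1 : ℂ) ≠ 0 := by exact_mod_cast h0
      simp only [hα, hβ, Matrix.of_apply]
      calc (z i).2.1 a p * (z i).2.2 q b
          = (d (z i).1 : ℂ) * (d (z i).1 : ℂ)⁻¹ * ((z i).2.1 a p * (z i).2.2 q b) := by
            rw [mul_inv_cancel₀ this, one_mul]
        _ = _ := by
            rw [← hsq i, Complex.ofReal_inv, ← hsq i]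
            ring
  · rw [← Matrix.l2_opNorm_conjTranspose]
    refine norm_le_sqrt_of_accretive _ ht ?_
    rwa [hαA]
  · refine norm_le_sqrt_of_accretive _ ht ?_
    rwa [hβB]
  · intro i
    rw [Complex.norm_real, Real.norm_eq_abs, abs_of_nonneg (inv_nonneg.2 (hd _))]
    exact inv_mul_le_one

end Norms

/-! ### Evaluation on the free space and the upper estimate -/

section Free

variable {H : Type*} [NormedAddCommGroup H] [InnerProductSpace ℂ H] {X : Set (H →L[ℂ] H)}
  {n m k : ℕ} {x₀ : X}

theorem matDist_le_sum_dist (x y : Matrix (Fin n) (Fin n) X) :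
    matDist x y ≤ ∑ i, ∑ j, dist (x i j) (y i j) := by
  refine ContinuousLinearMap.opNorm_le_bound _ (by positivity) fun v => ?_
  set B := blockOp (Matrix.of fun i j => (x i j : H →L[ℂ] H) - (y i j : H →L[ℂ] H)) with hB
  have h1 : ∀ i, (B v) i = ∑ j, ((x i j : H →L[ℂ] H) - (y i j : H →L[ℂ] H)) (v j) := by
    intro i
    simp [hB, blockOp]
  have h2 : ‖B v‖ ≤ ∑ i, ‖(B v) i‖ := by
    refine (sq_le_sq₀ (norm_nonneg _) (by positivity)).1 ?_
    rw [PiLp.norm_sq_eq_of_L2]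
    exact Finset.sum_sq_le_sq_sum_of_nonneg fun i _ => norm_nonneg _
  refine h2.trans ?_
  rw [Finset.sum_mul]
  refine Finset.sum_le_sum fun i _ => ?_
  rw [h1, Finset.sum_mul]
  refine (norm_sum_le _ _).trans (Finset.sum_le_sum fun j _ => ?_)
  refine (ContinuousLinearMap.le_opNorm _ _).trans ?_
  rw [Subtype.dist_eq, dist_eq_norm]
  exact mul_le_mul_of_nonneg_left (PiLp.norm_apply_le v j) (norm_nonneg _)

theorem eq_of_matDist_eq_zero {x y : Matrix (Fin n) (Fin n) X} (h : matDist x y = 0) : x = y := by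
  ext1 i j
  exact dist_le_zero.1 (h ▸ dist_entry_le x y i j)

variable [NeZero n]

theorem freeDelta_base : freeDelta n x₀ x₀ = 0 := by
  refine Subtype.ext (ContinuousLinearMap.ext fun f => ?_)
  exact f.2.2

/-- The matrix-valued linear map `v ↦ [v(f_rs)]` on the free space. -/
noncomputable def evalMatrix (f : Matrix (Fin k) (Fin k) (LipZero X n x₀)) :
    FreeSpace X n x₀ →ₗ[ℂ] Matrix (Fin k) (Fin k) ℂ where
  toFun v := Matrix.of fun r s => (v : StrongDual ℂ (LipZero X n x₀)) (f r s)
  map_add' _ _ := rfl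
  map_smul' _ _ := rfl

/-- The two matrices differ only in the order of the tensor indices. -/
theorem norm_amplify_eq (f : Matrix (Fin k) (Fin k) (LipZero X n x₀))
    (μ : Matrix (Fin m) (Fin m) (FreeSpace X n x₀)) :
    ‖amplify (toMatrixMap (μ.map fun φ => (φ : StrongDual ℂ (LipZero X n x₀)))) f‖
      = ‖ampMatrix (evalMatrix f) μ‖ := by
  rw [← norm_submatrix_equiv (ampMatrix (evalMatrix f) μ) (Equiv.prodComm _ _)
    (Equiv.prodComm _ _)]
  rfl

theorem ampMatrix_elemMatrix (f : Matrix (Fin k) (Fin k) (LipZero X n x₀))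
    (x y : Matrix (Fin n) (Fin n) X) :
    ampMatrix (evalMatrix f) (elemMatrix x y)
      = ampDiff (fun x => Matrix.of fun r s => f r s x) x y := rfl

/-- The cost of a representation bounds the norm from above. -/
theorem freeMatNorm_sandwich_le {N : ℕ} (α : Matrix (Fin m) (Fin n × Fin N) ℂ)
    (β : Matrix (Fin n × Fin N) (Fin m) ℂ) (c : Fin N → ℂ) (x y : Fin N → Matrix (Fin n) (Fin n) X) :
    freeMatNorm (sandwich α
      (Matrix.blockDiagonal fun l => c l • elemMatrix (x₀ := x₀) (x l) (y l)) β)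
      ≤ ‖α‖ * ‖β‖ * ⨆ l, ‖c l‖ * matDist (x l) (y l) := by
  have h0 : 0 ≤ ⨆ l, ‖c l‖ * matDist (x l) (y l) :=
    Real.iSup_nonneg fun l => mul_nonneg (norm_nonneg _) (matDist_nonneg _ _)
  refine Real.sSup_le ?_ (by positivity)
  rintro _ ⟨k, f, hf, rfl⟩
  rw [norm_amplify_eq]
  refine norm_ampMatrix_sandwich_blockDiagonal_le _ α _ β h0 fun l => ?_
  have h1 : ampMatrix (evalMatrix f) (c l • elemMatrix (x l) (y l))
      = c l • ampMatrix (evalMatrix f) (elemMatrix (x l) (y l)) := by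
    ext p q
    simp [ampMatrix]
  rw [h1, norm_smul, ampMatrix_elemMatrix]
  refine le_trans ?_ (le_ciSup (f := fun l => ‖c l‖ * matDist (x l) (y l))
    (Set.finite_range _).bddAbove l)
  refine mul_le_mul_of_nonneg_left ?_ (norm_nonneg _)
  refine (ampDiff_le f (x l) (y l)).trans ?_
  exact mul_le_of_le_one_left (matDist_nonneg _ _) hf

/-! ### The model of formal combinations of points and the lower estimate -/

variable (x₀) in
/-- Formal linear combinations of the points of `X` other than the base point. -/
abbrev PointSpace : Type _ := {x : X // x ≠ x₀} →₀ ℂ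

open scoped Classical in
variable (x₀) in
/-- The formal symbol of a point, the base point being sent to `0`. -/
noncomputable def pointDelta (x : X) : PointSpace x₀ :=
  if h : x = x₀ then 0 else Finsupp.single ⟨x, h⟩ 1

theorem pointDelta_base : pointDelta x₀ x₀ = 0 := dif_pos rfl

theorem pointDelta_coe (x : {x : X // x ≠ x₀}) : pointDelta x₀ x.1 = Finsupp.single x 1 :=
  dif_neg x.2

theorem span_range_pointDelta : Submodule.span ℂ (Set.range (pointDelta x₀)) = ⊤ := by
  refine eq_top_iff.2 fun v _ => ?_
  induction v using Finsupp.induction_linear with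
  | zero => exact Submodule.zero_mem _
  | add v w ihv ihw => exact Submodule.add_mem _ (ihv trivial) (ihw trivial)
  | single x c =>
    rw [← mul_one c, ← smul_eq_mul, ← Finsupp.smul_single, ← pointDelta_coe]
    exact Submodule.smul_mem _ _ (Submodule.subset_span ⟨_, rfl⟩)

variable (n x₀) in
/-- The linear map from formal combinations of points to the free space. -/
noncomputable def pointToFree : PointSpace x₀ →ₗ[ℂ] FreeSpace X n x₀ :=
  Finsupp.linearCombination ℂ fun x => freeDelta n x₀ x.1

theorem pointToFree_pointDelta (x : X) :
    pointToFree n x₀ (pointDelta x₀ x) = freeDelta n x₀ x := by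
  by_cases h : x = x₀
  · rw [h, pointDelta_base, map_zero, freeDelta_base]
  · rw [pointDelta_coe ⟨x, h⟩, pointToFree, Finsupp.linearCombination_single, one_smul]

theorem exists_pointToFree_eq {v : FreeSpace X n x₀} (hv : v ∈ freeSpan X n x₀) :
    ∃ w, pointToFree n x₀ w = v := by
  induction hv using Submodule.span_induction with
  | mem v hv =>
    obtain ⟨x, rfl⟩ := hv
    exact ⟨_, pointToFree_pointDelta x⟩
  | zero => exact ⟨0, map_zero _⟩
  | add v w _ _ ihv ihw =>
    obtain ⟨v', rfl⟩ := ihv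
    obtain ⟨w', rfl⟩ := ihw
    exact ⟨v' + w', map_add _ _ _⟩
  | smul c v _ ih =>
    obtain ⟨v', rfl⟩ := ih
    exact ⟨c • v', map_smul _ _ _⟩

variable (x₀) in
/-- The matrix `[x_ij - y_ij]` of differences of formal symbols. -/
noncomputable def pointElemMatrix (z : Matrix (Fin n) (Fin n) X × Matrix (Fin n) (Fin n) X) :
    Matrix (Fin n) (Fin n) (PointSpace x₀) :=
  Matrix.of fun i j => pointDelta x₀ (z.1 i j) - pointDelta x₀ (z.2 i j)

theorem map_pointElemMatrix (z : Matrix (Fin n) (Fin n) X × Matrix (Fin n) (Fin n) X) :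
    (pointElemMatrix x₀ z).map (pointToFree n x₀) = elemMatrix z.1 z.2 := by
  ext1 i j
  simp only [pointElemMatrix, elemMatrix, Matrix.map_apply, Matrix.of_apply]
  rw [map_sub, pointToFree_pointDelta, pointToFree_pointDelta]

theorem span_entries_pointElemMatrix : Submodule.span ℂ
    {w : PointSpace x₀ | ∃ z p q, w = pointElemMatrix (n := n) x₀ z p q} = ⊤ := by
  rw [eq_top_iff, ← span_range_pointDelta]
  refine Submodule.span_mono ?_
  rintro _ ⟨x, rfl⟩
  -- Since the base symbol is `0`, comparing constant matrices at `x` and `x₀` yields the symbol of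
  -- `x`; the entry `(0, 0)` exists because `n ≠ 0`.
  refine ⟨(Matrix.of fun _ _ => x, Matrix.of fun _ _ => x₀), 0, 0, ?_⟩
  simp [pointElemMatrix, pointDelta_base]

/-- The matrix of Lipschitz functions `x ↦ φ(δ_x)_rs` of a matrix-valued linear map `φ` whose
`n`-th amplification is bounded by the distance. -/
noncomputable def lipMatrix (φ : PointSpace x₀ →ₗ[ℂ] Matrix (Fin k) (Fin k) ℂ)
    (hφ : ∀ z, ‖ampMatrix φ (pointElemMatrix (n := n) x₀ z)‖ ≤ matDist z.1 z.2) :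
    Matrix (Fin k) (Fin k) (LipZero X n x₀) :=
  Matrix.of fun r s => ⟨fun x => φ (pointDelta x₀ x) r s, by
    constructor
    -- The constant counts the `n²` entries of two constant matrices; only finiteness matters here,
    -- the sharp bound being `lipMatNorm_lipMatrix_le`.
    · refine ⟨n * n, LipschitzWith.of_dist_le_mul fun x y => ?_⟩
      have h1 := hφ (Matrix.of fun _ _ => x, Matrix.of fun _ _ => y)
      have h2 := norm_entry_le (ampMatrix φ
        (pointElemMatrix (n := n) x₀ (Matrix.of fun _ _ => x, Matrix.of fun _ _ => y))) (0, r) (0, s)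
      have h3 := matDist_le_sum_dist (Matrix.of fun _ _ : Fin n => x) (Matrix.of fun _ _ => y)
      simp only [Matrix.of_apply, Finset.sum_const, Finset.card_univ, Fintype.card_fin,
        nsmul_eq_mul, ← mul_assoc] at h3
      refine le_trans (le_of_eq ?_) ((h2.trans h1).trans (h3.trans (le_of_eq ?_)))
      · rw [dist_eq_norm]
        simp [ampMatrix, pointElemMatrix]
      · push_cast
        rfl
    · simp [pointDelta_base]⟩

theorem lipMatNorm_lipMatrix_le (φ : PointSpace x₀ →ₗ[ℂ] Matrix (Fin k) (Fin k) ℂ)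
    (hφ : ∀ z, ‖ampMatrix φ (pointElemMatrix (n := n) x₀ z)‖ ≤ matDist z.1 z.2) :
    lipMatNorm (lipMatrix φ hφ) ≤ 1 := by
  refine lipMatNorm_le _ zero_le_one fun x y => ?_
  rw [one_mul]
  refine le_trans (le_of_eq ?_) (hφ (x, y))
  congr 1
  ext p q
  simp only [ampDiff, ampMatrix, pointElemMatrix, lipMatrix, Matrix.of_apply, map_sub,
    Matrix.sub_apply]
  rfl

/-- Both maps agree on the symbols, which span. Every admissible `φ` is thus evaluation at Lipschitz
functions, with no need for linear independence of the `δ_x`. -/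
theorem evalMatrix_lipMatrix (φ : PointSpace x₀ →ₗ[ℂ] Matrix (Fin k) (Fin k) ℂ)
    (hφ : ∀ z, ‖ampMatrix φ (pointElemMatrix (n := n) x₀ z)‖ ≤ matDist z.1 z.2) :
    evalMatrix (lipMatrix φ hφ) ∘ₗ pointToFree n x₀ = φ := by
  refine LinearMap.ext_on span_range_pointDelta ?_
  rintro _ ⟨x, rfl⟩
  rw [LinearMap.comp_apply, pointToFree_pointDelta]
  rfl

theorem freeMatNorm_nonneg (μ : Matrix (Fin m) (Fin m) (FreeSpace X n x₀)) :
    0 ≤ freeMatNorm μ := by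
  refine Real.sSup_nonneg ?_
  rintro _ ⟨k, f, -, rfl⟩
  exact norm_nonneg _


/-- An admissible `φ` is one competitor in the completely bounded norm, at level `k = m`;
boundedness of `cbSet` makes the real supremum dominate it. -/
theorem ampMatrix_le_freeMatNorm (φ : PointSpace x₀ →ₗ[ℂ] Matrix (Fin m) (Fin m) ℂ)
    (hφ : ∀ z, ‖ampMatrix φ (pointElemMatrix (n := n) x₀ z)‖ ≤ matDist z.1 z.2)
    (ν : Matrix (Fin m) (Fin m) (PointSpace x₀)) :
    ‖ampMatrix φ ν‖ ≤ freeMatNorm (ν.map (pointToFree n x₀)) := by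
  have h1 : ampMatrix φ ν = ampMatrix (evalMatrix (lipMatrix φ hφ)) (ν.map (pointToFree n x₀)) := by
    ext p q
    have := LinearMap.congr_fun (evalMatrix_lipMatrix φ hφ) (ν p.1 q.1)
    exact congrFun (congrFun this.symm p.2) q.2
  rw [h1, ← norm_amplify_eq]
  exact le_csSup (cbSet_bddAbove _) ⟨m, lipMatrix φ hφ, lipMatNorm_lipMatrix_le φ hφ, rfl⟩

theorem map_sandwich_pointElemMatrix {N : ℕ} (α : Matrix (Fin m) (Fin n × Fin N) ℂ)
    (β : Matrix (Fin n × Fin N) (Fin m) ℂ) (c : Fin N → ℂ)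
    (z : Fin N → Matrix (Fin n) (Fin n) X × Matrix (Fin n) (Fin n) X) :
    (sandwich α (Matrix.blockDiagonal fun l => c l • pointElemMatrix x₀ (z l)) β).map
        (pointToFree n x₀)
      = sandwich α (Matrix.blockDiagonal fun l => c l • elemMatrix (z l).1 (z l).2) β := by
  refine (sandwich_apply_of_linear (W := FreeSpace X n x₀) (pointToFree n x₀) α _ β).trans ?_
  rw [Matrix.blockDiagonal_map _ _ (map_zero _)]
  congr 2
  ext1 l
  rw [← map_pointElemMatrix]
  ext1 i j
  exact (pointToFree n x₀).map_smul _ _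

/-- Every matrix over the span of the evaluations has representations of cost arbitrarily close
to its norm. -/
theorem exists_representation_of_freeMatNorm_lt (hm : 0 < m)
    (μ : Matrix (Fin m) (Fin m) (FreeSpace X n x₀)) (hμ : ∀ a b, μ a b ∈ freeSpan X n x₀)
    {t : ℝ} (ht : freeMatNorm μ < t) :
    ∃ (N : ℕ) (_ : 0 < N) (α : Matrix (Fin m) (Fin n × Fin N) ℂ)
      (β : Matrix (Fin n × Fin N) (Fin m) ℂ) (c : Fin N → ℂ)
      (x y : Fin N → Matrix (Fin n) (Fin n) X),
      μ = sandwich α (Matrix.blockDiagonal fun l => c l • elemMatrix (x l) (y l)) β ∧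
      ‖α‖ * ‖β‖ * ⨆ l, ‖c l‖ * matDist (x l) (y l) ≤ t := by
  have ht0 : 0 ≤ t := (freeMatNorm_nonneg μ).trans ht.le
  -- Any lift serves: the estimate depends only on its image in the free space.
  choose ν₀ hν₀ using fun a b => exists_pointToFree_eq (hμ a b)
  let ν : Matrix (Fin m) (Fin m) (PointSpace x₀) := Matrix.of ν₀
  have hν : ∀ a b, pointToFree n x₀ (ν a b) = μ a b := hν₀
  have hd : ∀ z : Matrix (Fin n) (Fin n) X × Matrix (Fin n) (Fin n) X, 0 ≤ matDist z.1 z.2 :=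
    fun z => matDist_nonneg _ _
  have h1 : μ = ν.map (pointToFree n x₀) := by
    ext1 a b
    exact (hν a b).symm
  have hdom := mem_dominatedCone_of_forall_norm_le (e := pointElemMatrix (n := n) x₀)
    (d := fun z => matDist z.1 z.2) hd span_entries_pointElemMatrix hm ν (freeMatNorm_nonneg μ) ht
    fun φ hφ => by
      rw [h1]
      exact ampMatrix_le_freeMatNorm φ hφ ν
  have : Nonempty (Matrix (Fin n) (Fin n) X × Matrix (Fin n) (Fin n) X) :=
    ⟨(Matrix.of fun _ _ => x₀, Matrix.of fun _ _ => x₀)⟩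
  obtain ⟨N, hN, α, β, c, z, hrep, hα, hβ, hc⟩ := exists_blockDiagonal_representation
    (e := pointElemMatrix (n := n) x₀) (d := fun z => matDist z.1 z.2) hd (by
    intro z hz
    ext1 i j
    rw [pointElemMatrix, Matrix.of_apply, eq_of_matDist_eq_zero hz, sub_self]
    rfl) ht0 hdom
  refine ⟨N, hN, α, β, c, fun l => (z l).1, fun l => (z l).2, ?_, ?_⟩
  · rw [h1, hrep, map_sandwich_pointElemMatrix]
  · have h1 : ⨆ l, ‖c l‖ * matDist (z l).1 (z l).2 ≤ 1 := Real.iSup_le hc zero_le_one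
    calc _ ≤ Real.sqrt t * Real.sqrt t * 1 :=
          mul_le_mul (mul_le_mul hα hβ (norm_nonneg _) (Real.sqrt_nonneg _)) h1
            (Real.iSup_nonneg fun l => mul_nonneg (norm_nonneg _) (matDist_nonneg _ _))
            (by positivity)
      _ = t := by rw [mul_one, Real.mul_self_sqrt ht0]

end Free

end OpLip

/-- Existence of representations is included, since the empty set of reals has no greatest lower
bound. As `N > 0`, the supremum over `Fin N` is a maximum. -/
theorem mainTheorem9 {H : Type*} [NormedAddCommGroup H] [InnerProductSpace ℂ H] [CompleteSpace H]
    (X : Set (H →L[ℂ] H)) (x₀ : X) (n : ℕ) [NeZero n] (m : ℕ) (hm : 0 < m)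
    (μ : Matrix (Fin m) (Fin m) (OpLip.FreeSpace X n x₀))
    (hμ : ∀ a b, μ a b ∈ OpLip.freeSpan X n x₀) :
    IsGLB
      {t : ℝ | ∃ (N : ℕ) (_ : 0 < N)
        (α : Matrix (Fin m) (Fin n × Fin N) ℂ) (β : Matrix (Fin n × Fin N) (Fin m) ℂ)
        (c : Fin N → ℂ) (x y : Fin N → Matrix (Fin n) (Fin n) X),
        μ = OpLip.sandwich α
          (Matrix.blockDiagonal fun l => c l • OpLip.elemMatrix (x l) (y l)) β ∧
        t = ‖α‖ * ‖β‖ * ⨆ l, ‖c l‖ * OpLip.matDist (x l) (y l)}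
      (OpLip.freeMatNorm μ) := by
  constructor
  · rintro _ ⟨N, -, α, β, c, x, y, rfl, rfl⟩
    exact OpLip.freeMatNorm_sandwich_le α β c x y
  · intro b hb
    refine le_of_forall_gt_imp_ge_of_dense fun t ht => ?_
    obtain ⟨N, hN, α, β, c, x, y, hrep, hle⟩ :=
      OpLip.exists_representation_of_freeMatNorm_lt hm μ hμ ht
    exact (hb ⟨N, hN, α, β, c, x, y, hrep, rfl⟩).trans hle
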